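/- Let $A,B,C$ be systems of $n_A,n_B,n_C$ qubits, with Hilbert space dimensions $d_A=2^{n_A}$, $d_B=2^{n_B}$, $d_C=2^{n_C}$, and put $d=d_Ad_Bd_C$. Let $|\Psi\rangle$ be a Haar random pure state on $ABC$ (uniformly distributed on the unit sphere of $\mathbb C^{d}$), and let $\rho_{AB}=\operatorname{Tr}_C|\Psi\rangle\langle\Psi|$. For $0<h\le 1$, the one-shot LO-distillable entanglement $E^{[\mathrm{LO}]}_{D,h}(A:B)$ is the supremum of all $m\in\mathbb N$ for which there are quantum channels (completely positive trace preserving maps) $\Phi_A$ from $A$ to an $m$-qubit register $R_A$ and $\Phi_B$ from $B$ to an $m$-qubit register $R_B$ such that $$\operatorname{Tr}\big((\Phi_A\otimes\Phi_B)(\rho_{AB})\,\Pi^{[\mathrm{EPR}]}_{R_AR_B}\big)\ \ge\ h^2,$$ where $\Pi^{[\mathrm{EPR}]}_{R_AR_B}$ is the projector onto the state $\big(\tfrac{1}{\sqrt2}(|00\rangle+|11\rangle)\big)^{\otimes m}$ of $m$ EPR pairs shared between $R_A$ and $R_B$. Theorem. For every constant $0<c<1$ there is a constant $K>0$, depending only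 on $c$, such that for all $n_A,n_B,n_C,m\in\mathbb N$ and all $0<h\le1$ with $\delta:=h^2-2^{-m}>0$, $$\log\Pr\big[E^{[\mathrm{LO}]}_{D,h}(A:B)\ge m\big]\ \le\ -c\,\delta^2 d+K\,2^{2m}\,(d_A^2+d_B^2)\,\log\frac1\delta ,$$ where $\log$ is the natural logarithm and $\log 0=-\infty$. -/

import Mathlib

open MeasureTheory
open scoped Kronecker

noncomputable section

namespace LOEntanglement

/-- Labels of the computational basis of `n` qubits, i.e. bit strings of length `n`. -/
abbrev Qubits (n : ℕ) : Type := Fin n → Fin 2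

/-- The Hilbert space of a quantum system with computational basis labelled by `ι`. -/
abbrev Hilb (ι : Type) [Fintype ι] : Type := EuclideanSpace ℂ ι

/-- The set of pure states (unit vectors). -/
abbrev PureState (ι : Type) [Fintype ι] : Type := Metric.sphere (0 : Hilb ι) 1

/-- The law of a Haar random pure state: the uniform probability distribution on the unit sphere,
that is, the normalized surface measure. -/
def haarState (ι : Type) [Fintype ι] : Measure (PureState ι) :=
  ((volume : Measure (Hilb ι)).toSphere Set.univ)⁻¹ • (volume : Measure (Hilb ι)).toSphere

instance haarState_isProbabilityMeasure (ι : Type) [Fintype ι] [Nonempty ι] :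
    IsProbabilityMeasure (haarState ι) := by
  have h : (volume : Measure (Hilb ι)).toSphere ≠ 0 := Measure.toSphere_ne_zero _
  refine ⟨?_⟩
  rw [haarState, Measure.smul_apply, smul_eq_mul]
  exact ENNReal.inv_mul_cancel (fun h0 => h (Measure.measure_univ_eq_zero.mp h0))
    (measure_ne_top _ _)

/-- The density matrix `|ψ⟩⟨ψ|`. -/
def density {ι : Type} [Fintype ι] (ψ : Hilb ι) : Matrix ι ι ℂ :=
  Matrix.of fun i j => ψ i * star (ψ j)

/-- The partial trace over the second tensor factor. -/
def partialTrace {a c : Type} [Fintype c] (M : Matrix (a × c) (a × c) ℂ) : Matrix a a ℂ :=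
  Matrix.of fun i j => ∑ k, M (i, k) (j, k)

open scoped MatrixOrder Matrix.Norms.L2Operator in
/-- A quantum channel: a completely positive trace preserving linear map between matrix algebras.
(A matrix is nonnegative in the order used here iff it is positive semidefinite.) -/
structure Channel (a b : Type) [Fintype a] [DecidableEq a] [Fintype b] [DecidableEq b]
    extends CompletelyPositiveMap (Matrix a a ℂ) (Matrix b b ℂ) where
  trace_map : ∀ X : Matrix a a ℂ, (toFun X).trace = X.trace

open scoped MatrixOrder Matrix.Norms.L2Operator in
/-- The linear map underlying a quantum channel. -/
def Channel.lin {a b : Type} [Fintype a] [DecidableEq a] [Fintype b] [DecidableEq b]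
    (Φ : Channel a b) : Matrix a a ℂ →ₗ[ℂ] Matrix b b ℂ :=
  Φ.toLinearMap

/-- The tensor product `Φ ⊗ Ψ` of two linear maps between matrix algebras, expanded in the matrix
units of the input system. -/
def tensorMap {a b a' b' : Type} [Fintype a] [DecidableEq a] [Fintype b] [DecidableEq b]
    (Φ : Matrix a a ℂ →ₗ[ℂ] Matrix a' a' ℂ) (Ψ : Matrix b b ℂ →ₗ[ℂ] Matrix b' b' ℂ)
    (M : Matrix (a × b) (a × b) ℂ) : Matrix (a' × b') (a' × b') ℂ :=
  ∑ p : a × b, ∑ q : a × b,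
    M p q • (Φ (Matrix.single p.1 q.1 1) ⊗ₖ Ψ (Matrix.single p.2 q.2 1))

/-- On product inputs, `tensorMap` is what it should be; by linearity this determines it. -/
theorem tensorMap_kronecker {a b a' b' : Type} [Fintype a] [DecidableEq a] [Fintype b]
    [DecidableEq b] (Φ : Matrix a a ℂ →ₗ[ℂ] Matrix a' a' ℂ)
    (Ψ : Matrix b b ℂ →ₗ[ℂ] Matrix b' b' ℂ) (X : Matrix a a ℂ) (Y : Matrix b b ℂ) :
    tensorMap Φ Ψ (X ⊗ₖ Y) = Φ X ⊗ₖ Ψ Y := by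
  have key : ∀ {c c' : Type} [Fintype c] [DecidableEq c] (Θ : Matrix c c ℂ →ₗ[ℂ] Matrix c' c' ℂ)
      (Z : Matrix c c ℂ) (u v : c'),
      Θ Z u v = ∑ i, ∑ j, Z i j * Θ (Matrix.single i j 1) u v := by
    intro c c' _ _ Θ Z u v
    have h : Z = ∑ i, ∑ j, Z i j • Matrix.single i j (1 : ℂ) := by
      conv_lhs => rw [Matrix.matrix_eq_sum_single Z]
      simp [Matrix.smul_single]
    conv_lhs => rw [h]
    simp only [map_sum, map_smul, Matrix.sum_apply, Matrix.smul_apply, smul_eq_mul]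
  ext ⟨u, u'⟩ ⟨v, v'⟩
  simp only [tensorMap, Matrix.sum_apply, Matrix.smul_apply, Matrix.kroneckerMap_apply,
    smul_eq_mul]
  rw [key Φ X u v, key Ψ Y u' v', Finset.sum_mul_sum, Fintype.sum_prod_type]
  refine Finset.sum_congr rfl fun i _ => Finset.sum_congr rfl fun i' _ => ?_
  rw [Finset.sum_mul_sum, Fintype.sum_prod_type]
  refine Finset.sum_congr rfl fun j _ => Finset.sum_congr rfl fun j' _ => ?_
  ring

/-- The amplitudes of one EPR pair `(|00⟩ + |11⟩) / √2`. -/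
def eprAmp (x y : Fin 2) : ℂ := if x = y then ((Real.sqrt 2 : ℝ) : ℂ)⁻¹ else 0

/-- The state of `m` EPR pairs shared between two registers of `m` qubits: the `i`-th qubit of the
first register forms an EPR pair with the `i`-th qubit of the second one. -/
def eprState (m : ℕ) : Hilb (Qubits m × Qubits m) :=
  WithLp.toLp 2 fun p => ∏ i, eprAmp (p.1 i) (p.2 i)

/-- The projector onto `m` EPR pairs. -/
def eprProj (m : ℕ) : Matrix (Qubits m × Qubits m) (Qubits m × Qubits m) ℂ :=
  density (eprState m)

/-- By some local operation `Φ_A ⊗ Φ_B`, the bipartite state `ρ` can be turned into a state of two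
`m`-qubit registers which has fidelity at least `h ^ 2` with `m` EPR pairs. -/
def LODistillable {a b : Type} [Fintype a] [DecidableEq a] [Fintype b] [DecidableEq b]
    (h : ℝ) (ρ : Matrix (a × b) (a × b) ℂ) (m : ℕ) : Prop :=
  ∃ (ΦA : Channel a (Qubits m)) (ΦB : Channel b (Qubits m)),
    h ^ 2 ≤ ((tensorMap ΦA.lin ΦB.lin ρ * eprProj m).trace).re

/-- The one-shot LO-distillable entanglement with fidelity `h ^ 2`. -/
def distillableLO {a b : Type} [Fintype a] [DecidableEq a] [Fintype b] [DecidableEq b]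
    (h : ℝ) (ρ : Matrix (a × b) (a × b) ℂ) : ℕ∞ :=
  ⨆ (m : ℕ) (_ : LODistillable h ρ m), (m : ℕ∞)

/-- The reduced state `ρ_AB = Tr_C |ψ⟩⟨ψ|` of a pure state on `ABC`. -/
def reducedAB {a b c : Type} [Fintype a] [Fintype b] [Fintype c] (ψ : PureState ((a × b) × c)) :
    Matrix (a × b) (a × b) ℂ :=
  partialTrace (density (ψ : Hilb ((a × b) × c)))

end LOEntanglement

end

noncomputable section

namespace LOEntanglement

/-! Dilate the two local channels to isometries V and W. The fidelity reached is then ‖Fψ‖², where F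
= `overlapMap V W` extracts the maximally entangled component of (V ⊗ W ⊗ 1)ψ. This F is a
contraction (`norm_overlapMap_le`) and tr F*F ≤ 2^{-m} d (`sum_norm_sq_overlapMap_single_le`). So
for a fixed protocol the mean fidelity is at most 2^{-m}, and exceeding 2^{-m} by x has probability
at most exp(-d x²) (`haarState_sq_norm_tail`). To see this, note that ‖Fψ‖² ≥ τ cuts out a cone,
whose Haar measure equals its Gaussian measure; the exponential Markov inequality then leads to a
Gaussian integral that factors in an eigenbasis of F*F.

A union bound over nets of isometries (`exists_finset_net`) handles all protocols at once. The
logarithm of the size of a net is its real dimension times log(1 + 2/ε), so the number of Kraus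
operators matters. Counting d_A 2^m of them would give a dimension of order 2^{2m} d_A². By
`exists_kraus_card`, d_A operators suffice: the fidelity is linear in each channel, and Choi's
argument for the Kraus rank of extreme channels removes operators one at a time without lowering it.
This leaves dimension 2·2^m d_A². The second factor 2^m of the error term absorbs the constant in
log(1 + 2/ε), because log(1/δ) is only known to be at least 2^{-m} (`net_exponent_le`). Protocols
producing more than m pairs are reduced to m pairs by `krausFidelity_le_discard`. -/

/-! ### Relative entropy and the Chernoff exponent. -/

/-- The Bernoulli relative entropy dominates the squared distance of the parameters. -/
theorem sq_sub_le_bernoulli_kl {p τ : ℝ} (hp : 0 < p) (hpτ : p < τ) (hτ : τ < 1) :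
    (τ - p) ^ 2 ≤ p * Real.log (p / τ) + (1 - p) * Real.log ((1 - p) / (1 - τ)) := by
  have hτ0 : 0 < τ := hp.trans hpτ
  -- From log z ≤ z - 1 at z = √(y/x): relative entropy dominates the squared Hellinger distance.
  have key : ∀ x y : ℝ, 0 < x → 0 < y →
      2 * x - 2 * (Real.sqrt x * Real.sqrt y) ≤ x * Real.log (x / y) := by
    intro x y hx hy
    have h1 : Real.log (y / x) = 2 * Real.log (Real.sqrt (y / x)) := by
      rw [Real.log_sqrt (by positivity)]; ring
    have h2 := Real.log_le_sub_one_of_pos (Real.sqrt_pos.2 (div_pos hy hx))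
    have h3 : Real.log (x / y) = - Real.log (y / x) := by rw [← Real.log_inv, inv_div]
    have h4 : x * Real.sqrt (y / x) = Real.sqrt x * Real.sqrt y := by
      rw [Real.sqrt_div hy.le]
      field_simp
      rw [Real.sq_sqrt hx.le]
    rw [h3, h1]
    nlinarith
  have h1 := key p τ hp hτ0
  have h2 := key (1 - p) (1 - τ) (by linarith) (by linarith)
  have sp := Real.sq_sqrt hp.le
  have st := Real.sq_sqrt hτ0.le
  have sp' := Real.sq_sqrt (show 0 ≤ 1 - p by linarith)
  have st' := Real.sq_sqrt (show 0 ≤ 1 - τ by linarith)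
  have a0 := Real.sqrt_pos.2 hp
  have b0 := Real.sqrt_pos.2 hτ0
  have c0 := Real.sqrt_pos.2 (show 0 < 1 - p by linarith)
  have d0 := Real.sqrt_pos.2 (show 0 < 1 - τ by linarith)
  set a := Real.sqrt p
  set b := Real.sqrt τ
  set c := Real.sqrt (1 - p)
  set d := Real.sqrt (1 - τ)
  have e1 : τ - p = (b - a) * (b + a) := by rw [← sp, ← st]; ring
  have e2 : τ - p = (c - d) * (c + d) := by
    have : τ - p = (1 - p) - (1 - τ) := by ring
    rw [this, ← sp', ← st']; ring
  -- With s = a + b and t = c + d, s² + t² ≤ 4 forces 1/s² + 1/t² ≥ 1; `e1` and `e2` write τ - p as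
  -- a multiple of s and of t.
  have hs : (a + b) ^ 2 + (c + d) ^ 2 ≤ 4 := by nlinarith [sq_nonneg (a - b), sq_nonneg (c - d)]
  have hgoal : (τ - p) ^ 2 ≤ (b - a) ^ 2 + (c - d) ^ 2 := by
    set x := τ - p
    set s := a + b
    set t := c + d
    have s0 : 0 < s := by positivity
    have t0 : 0 < t := by positivity
    have hb : b - a = x / s := by rw [eq_div_iff s0.ne']; simp only [s]; rw [e1]; ring
    have hc : c - d = x / t := by rw [eq_div_iff t0.ne', e2]
    rw [hb, hc, div_pow, div_pow]
    have : 1 ≤ 1 / s ^ 2 + 1 / t ^ 2 := by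
      rw [div_add_div _ _ (by positivity) (by positivity), le_div_iff₀ (by positivity)]
      nlinarith [sq_nonneg (s ^ 2 - t ^ 2), sq_nonneg (s * t), sq_nonneg (s^2+t^2)]
    calc x ^ 2 = x ^ 2 * 1 := by ring
      _ ≤ x ^ 2 * (1 / s ^ 2 + 1 / t ^ 2) := by gcongr
      _ = _ := by ring
  nlinarith

/-- The optimized Chernoff bound for a product of moment generating functions of exponential
variables. -/
theorem exists_prod_inv_le_exp {n : ℕ} (lam : Fin n → ℝ) (h0 : ∀ i, 0 ≤ lam i)
    (h1 : ∀ i, lam i ≤ 1) {p τ D : ℝ} (hp : 0 < p) (hpτ : p < τ) (hτ : τ < 1) (hD : (n : ℝ) = D)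
    (hsum : ∑ i, lam i ≤ p * D) :
    ∃ t : ℝ, 0 ≤ t ∧ (∀ i, 0 < 1 - t * (lam i - τ)) ∧
      (∏ i, (1 - t * (lam i - τ)))⁻¹ ≤ Real.exp (-(D * (τ - p) ^ 2)) := by
  have hτ0 : 0 < τ := hp.trans hpτ
  have hτ1 : 0 < 1 - τ := by linarith
  -- The optimal parameter in the extreme case where every `lam i` is 0 or 1, with mean p.
  set t := (τ - p) / (τ * (1 - τ)) with ht
  have ht0 : 0 ≤ t := div_nonneg (by linarith) (by positivity)
  have eu : 1 + t * τ = (1 - p) / (1 - τ) := by rw [ht]; field_simp; ring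
  have ev : 1 - t * (1 - τ) = p / τ := by rw [ht]; field_simp; ring
  have u0 : 0 < (1 - p) / (1 - τ) := div_pos (by linarith) hτ1
  have v0 : 0 < p / τ := div_pos hp hτ0
  set u := Real.log ((1 - p) / (1 - τ)) with hu
  set v := Real.log (p / τ) with hv
  -- Each factor is a weighted arithmetic mean of its values at `lam i` = 0 and 1. AM-GM makes the
  -- exponent affine in `lam i`, so only the sum of the `lam i` matters.
  have hexp : ∀ i, Real.exp ((1 - lam i) * u + lam i * v) ≤ 1 - t * (lam i - τ) := by
    intro i
    have := Real.geom_mean_le_arith_mean2_weighted (w₁ := 1 - lam i) (w₂ := lam i)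
      (by linarith [h1 i]) (h0 i) u0.le v0.le (by ring)
    rw [Real.rpow_def_of_pos u0, Real.rpow_def_of_pos v0, ← Real.exp_add, ← eu, ← ev] at this
    rw [eu, ev] at this
    calc _ = Real.exp (u * (1 - lam i) + v * lam i) := by ring_nf
      _ ≤ _ := this
      _ = _ := by rw [← eu, ← ev]; ring
  refine ⟨t, ht0, fun i => (Real.exp_pos _).trans_le (hexp i), ?_⟩
  have hprod : Real.exp (∑ i, ((1 - lam i) * u + lam i * v)) ≤ ∏ i, (1 - t * (lam i - τ)) := by
    rw [Real.exp_sum]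
    exact Finset.prod_le_prod (fun i _ => (Real.exp_pos _).le) fun i _ => hexp i
  have hsum' : ∑ i, ((1 - lam i) * u + lam i * v) = D * u - (∑ i, lam i) * (u - v) := by
    rw [Finset.sum_mul, ← hD]
    have : (n : ℝ) * u = ∑ _i : Fin n, u := by simp
    rw [this, ← Finset.sum_sub_distrib]
    exact Finset.sum_congr rfl fun i _ => by ring
  have huv : 0 ≤ u - v := by
    have hu0 : 0 ≤ u := Real.log_nonneg (by rw [le_div_iff₀ hτ1]; linarith)
    have hv0 : v ≤ 0 := Real.log_nonpos v0.le (by rw [div_le_iff₀ hτ0]; linarith)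
    linarith
  have hD0 : 0 ≤ D := by rw [← hD]; positivity
  have hkl := sq_sub_le_bernoulli_kl hp hpτ hτ
  calc (∏ i, (1 - t * (lam i - τ)))⁻¹ ≤ (Real.exp (∑ i, ((1 - lam i) * u + lam i * v)))⁻¹ :=
        inv_anti₀ (Real.exp_pos _) hprod
    _ = Real.exp (-(∑ i, ((1 - lam i) * u + lam i * v))) := by rw [Real.exp_neg]
    _ ≤ _ := by
      rw [Real.exp_le_exp, hsum']
      have := mul_le_mul_of_nonneg_right hsum huv
      have := mul_le_mul_of_nonneg_left hkl hD0
      nlinarith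

/-! ### Gaussian integrals and concentration on the sphere. -/

/-- In polar coordinates, the Gaussian weight of a cone is proportional to the uniform measure of
its trace on the sphere. -/
theorem setLIntegral_gaussian_cone {ι : Type} [Fintype ι] [Nonempty ι] (A : Set (Hilb ι))
    (hA : MeasurableSet A) (hcone : ∀ (r : ℝ) (x : Hilb ι), 0 < r → (r • x ∈ A ↔ x ∈ A)) :
    ∫⁻ x in A, ENNReal.ofReal (Real.exp (-‖x‖ ^ 2)) =
      haarState ι {ψ | (ψ : Hilb ι) ∈ A} * ∫⁻ x : Hilb ι, ENNReal.ofReal (Real.exp (-‖x‖ ^ 2)) := by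
  set μ : Measure (Hilb ι) := volume
  set N : Measure (Set.Ioi (0 : ℝ)) := Measure.volumeIoiPow (Module.finrank ℝ (Hilb ι) - 1)
  set C : ENNReal := ∫⁻ r, ENNReal.ofReal (Real.exp (-(r : ℝ) ^ 2)) ∂N
  have hpolar : ∀ B : Set (Hilb ι), MeasurableSet B →
      (∀ (r : ℝ) (x : Hilb ι), 0 < r → (r • x ∈ B ↔ x ∈ B)) →
      ∫⁻ x in B, ENNReal.ofReal (Real.exp (-‖x‖ ^ 2)) ∂μ =
        μ.toSphere {ψ | (ψ : Hilb ι) ∈ B} * C := by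
    intro B hB hc
    have hBs : MeasurableSet {ψ : PureState ι | (ψ : Hilb ι) ∈ B} := measurable_subtype_coe hB
    have hmp := μ.measurePreserving_homeomorphUnitSphereProd
    have hcompl : MeasurableSet ({0}ᶜ : Set (Hilb ι)) := (measurableSet_singleton _).compl
    rw [← lintegral_indicator hB]
    have hr : μ.restrict ({0}ᶜ) = μ := restrict_compl_singleton 0
    conv_lhs => rw [← hr, ← lintegral_subtype_comap hcompl]
    set G : PureState ι × Set.Ioi (0 : ℝ) → ENNReal := fun y =>
      {ψ : PureState ι | (ψ : Hilb ι) ∈ B}.indicator (1 : PureState ι → ENNReal) y.1 *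
        ENNReal.ofReal (Real.exp (-(y.2 : ℝ) ^ 2)) with hG
    have hGm1 : Measurable ({ψ : PureState ι | (ψ : Hilb ι) ∈ B}.indicator (1 : PureState ι → ENNReal)) :=
      measurable_one.indicator hBs
    have hGm2 : Measurable fun r : Set.Ioi (0 : ℝ) =>
        ENNReal.ofReal (Real.exp (-(r : ℝ) ^ 2)) := by fun_prop
    have hGm : Measurable G := (hGm1.comp measurable_fst).mul (hGm2.comp measurable_snd)
    have e : ∀ x : ({0}ᶜ : Set (Hilb ι)),
        B.indicator (fun x => ENNReal.ofReal (Real.exp (-‖x‖ ^ 2))) x =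
          G (homeomorphUnitSphereProd (Hilb ι) x) := by
      intro x
      have hx : 0 < ‖(x : Hilb ι)‖ := norm_pos_iff.2 x.2
      have hmem : ‖(x : Hilb ι)‖⁻¹ • (x : Hilb ι) ∈ B ↔ (x : Hilb ι) ∈ B :=
        hc _ _ (inv_pos.2 hx)
      by_cases h : (x : Hilb ι) ∈ B
      · simp [hG, Set.indicator, h, hmem]
      · simp [hG, Set.indicator, h, hmem]
    simp_rw [e]
    rw [hmp.lintegral_comp hGm, lintegral_prod_mul hGm1.aemeasurable hGm2.aemeasurable,
      lintegral_indicator_one hBs]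
  -- The radial integral C is the same for every cone; the whole space identifies it.
  have hU := hpolar Set.univ MeasurableSet.univ (by simp)
  rw [Measure.restrict_univ] at hU
  rw [hpolar A hA hcone, hU, haarState, Measure.smul_apply, smul_eq_mul]
  have hne : μ.toSphere Set.univ ≠ 0 := by
    rw [Ne, Measure.measure_univ_eq_zero]
    exact Measure.toSphere_ne_zero _
  have : {ψ : PureState ι | (ψ : Hilb ι) ∈ (Set.univ : Set (Hilb ι))} = Set.univ := by simp
  rw [this, mul_comm (μ.toSphere Set.univ)⁻¹, mul_assoc, ← mul_assoc (_⁻¹),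
    ENNReal.inv_mul_cancel hne (measure_ne_top _ _), one_mul]

/-- The Gaussian integral of a quadratic form that is diagonal in an orthonormal basis. -/
theorem lintegral_gaussian_diagonal {ι : Type} [Fintype ι] {n : ℕ}
    (b : OrthonormalBasis (Fin n) ℂ (Hilb ι)) (a : Fin n → ℝ) (ha : ∀ i, 0 < a i) :
    ∫⁻ x : Hilb ι, ENNReal.ofReal (Real.exp (-∑ i, a i * ‖b.repr x i‖ ^ 2)) =
      ENNReal.ofReal (∏ i, a i)⁻¹ *
        ∫⁻ x : Hilb ι, ENNReal.ofReal (Real.exp (-‖x‖ ^ 2)) := by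
  let S : Hilb ι →ₗ[ℂ] Hilb ι :=
    Matrix.toLin b.toBasis b.toBasis (Matrix.diagonal fun i => ((Real.sqrt (a i) : ℝ) : ℂ))
  have hrepr : ∀ x i, b.repr (S x) i = (Real.sqrt (a i) : ℂ) * b.repr x i := by
    intro x i
    have h := congrFun (LinearMap.toMatrix_mulVec_repr b.toBasis b.toBasis S x) i
    simp only [S, LinearMap.toMatrix_toLin, Matrix.mulVec_diagonal,
      OrthonormalBasis.coe_toBasis_repr_apply] at h
    exact h.symm
  have hnorm : ∀ x, ‖S x‖ ^ 2 = ∑ i, a i * ‖b.repr x i‖ ^ 2 := by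
    intro x
    rw [← b.repr.norm_map, EuclideanSpace.norm_sq_eq]
    refine Finset.sum_congr rfl fun i _ => ?_
    rw [hrepr, norm_mul, mul_pow, Complex.norm_real, Real.norm_eq_abs, sq_abs,
      Real.sq_sqrt (ha i).le]
  -- The real determinant is the squared modulus of the complex one, so the square roots disappear.
  have hdet : LinearMap.det (S.restrictScalars ℝ) = ∏ i, a i := by
    rw [LinearMap.det_restrictScalars, LinearMap.det_toLin, Matrix.det_diagonal, map_prod]
    refine Finset.prod_congr rfl fun i _ => ?_
    rw [Algebra.norm_complex_apply, Complex.normSq_ofReal, Real.mul_self_sqrt (ha i).le]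
  have hpos : 0 < ∏ i, a i := Finset.prod_pos fun i _ => ha i
  have hmap := Measure.map_linearMap_addHaar_eq_smul_addHaar (volume : Measure (Hilb ι))
    (f := S.restrictScalars ℝ) (by rw [hdet]; exact hpos.ne')
  have hSm : Measurable (S.restrictScalars ℝ) :=
    (LinearMap.continuous_of_finiteDimensional _).measurable
  calc _ = ∫⁻ x : Hilb ι, ENNReal.ofReal (Real.exp (-‖S.restrictScalars ℝ x‖ ^ 2)) := by
        refine lintegral_congr fun x => ?_
        rw [LinearMap.restrictScalars_apply, hnorm]
    _ = ∫⁻ x : Hilb ι, ENNReal.ofReal (Real.exp (-‖x‖ ^ 2))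
          ∂(Measure.map (S.restrictScalars ℝ) volume) :=
        (lintegral_map (f := fun x : Hilb ι => ENNReal.ofReal (Real.exp (-‖x‖ ^ 2)))
          (by fun_prop) hSm).symm
    _ = _ := by
        rw [hmap, lintegral_smul_measure, hdet, abs_of_pos (inv_pos.2 hpos), smul_eq_mul]

theorem lintegral_gaussian_ne_zero (ι : Type) [Fintype ι] :
    ∫⁻ x : Hilb ι, ENNReal.ofReal (Real.exp (-‖x‖ ^ 2)) ≠ 0 := by
  rw [Ne, lintegral_eq_zero_iff (by fun_prop)]
  intro h
  have : (volume : Measure (Hilb ι)) Set.univ = 0 := by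
    have := h.mono (p := _) (q := fun _ => False) (by
      intro x hx
      have := Real.exp_pos (-‖x‖ ^ 2)
      simp only [Pi.zero_apply, ENNReal.ofReal_eq_zero] at hx
      linarith)
    simpa [ae_iff] using this
  exact (IsOpen.measure_pos volume (isOpen_univ (X := Hilb ι)) Set.univ_nonempty).ne' this

theorem lintegral_gaussian_ne_top (ι : Type) [Fintype ι] :
    ∫⁻ x : Hilb ι, ENNReal.ofReal (Real.exp (-‖x‖ ^ 2)) ≠ ⊤ := by
  have h : Integrable (fun x : Hilb ι => Real.exp (-‖x‖ ^ 2)) := by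
    have h := (GaussianFourier.integrable_cexp_neg_mul_sq_norm_add (V := Hilb ι) (b := 1)
      (by simp) 0 0).norm
    refine h.congr (Filter.Eventually.of_forall fun x => ?_)
    simp only [Complex.norm_exp]
    congr 1
    simp [← Complex.ofReal_pow]
  have h2 := h.lintegral_lt_top
  exact h2.ne

/-- Concentration of a contractive quadratic form on Haar random pure states. -/
theorem haarState_sq_norm_tail {ι κ : Type} [Fintype ι] [DecidableEq ι] [Nonempty ι] [Fintype κ]
    (F : Hilb ι →ₗ[ℂ] Hilb κ) (hF : ∀ x, ‖F x‖ ≤ ‖x‖) {p τ : ℝ} (hp : 0 < p) (hpτ : p < τ)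
    (hτ : τ < 1) (htr : ∑ i, ‖F (EuclideanSpace.single i 1)‖ ^ 2 ≤ p * Fintype.card ι) :
    haarState ι {ψ | τ ≤ ‖F ψ‖ ^ 2} ≤
      ENNReal.ofReal (Real.exp (-(Fintype.card ι * (τ - p) ^ 2))) := by
  set T : Hilb ι →ₗ[ℂ] Hilb ι := LinearMap.adjoint F ∘ₗ F with hTdef
  have hT : T.IsSymmetric := by
    intro x y
    simp [hTdef, LinearMap.adjoint_inner_left, LinearMap.adjoint_inner_right]
  have hTF : ∀ x, inner ℂ x (T x) = ((‖F x‖ ^ 2 : ℝ) : ℂ) := by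
    intro x
    rw [hTdef, LinearMap.comp_apply, LinearMap.adjoint_inner_right, inner_self_eq_norm_sq_to_K]
    push_cast
    rfl
  have hn : Module.finrank ℂ (Hilb ι) = Fintype.card ι := finrank_euclideanSpace
  set b := hT.eigenvectorBasis hn
  set lam := hT.eigenvalues hn
  have hquad : ∀ x, ‖F x‖ ^ 2 = ∑ i, lam i * ‖b.repr x i‖ ^ 2 := by
    intro x
    have h := hTF x
    rw [← b.repr.inner_map_map, PiLp.inner_apply] at h
    have h2 : ∀ i, inner ℂ (b.repr x i) (b.repr (T x) i) =
        ((lam i * ‖b.repr x i‖ ^ 2 : ℝ) : ℂ) := by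
      intro i
      rw [hT.eigenvectorBasis_apply_self_apply hn x i]
      simp only [RCLike.inner_apply]
      rw [mul_assoc, RCLike.mul_conj]
      push_cast
      rfl
    simp_rw [h2] at h
    rw [← Complex.ofReal_sum] at h
    exact (Complex.ofReal_injective h).symm
  have hlam : ∀ i, lam i = ‖F (b i)‖ ^ 2 := by
    intro i
    rw [hquad]
    simp [PiLp.single_apply, ite_pow, apply_ite (fun z : ℂ => ‖z‖)]
  have h0 : ∀ i, 0 ≤ lam i := fun i => by rw [hlam]; positivity
  have h1 : ∀ i, lam i ≤ 1 := fun i => by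
    rw [hlam]
    have := hF (b i)
    rw [b.norm_eq_one] at this
    exact pow_le_one₀ (norm_nonneg _) this
  have hsum : ∑ i, lam i = ∑ i, ‖F (EuclideanSpace.single i 1)‖ ^ 2 := by
    have e1 := LinearMap.trace_eq_sum_inner T b
    have e2 := LinearMap.trace_eq_sum_inner T (EuclideanSpace.basisFun ι ℂ)
    rw [e1] at e2
    simp_rw [hTF] at e2
    rw [← Complex.ofReal_sum, ← Complex.ofReal_sum] at e2
    simp_rw [hlam]
    simpa using Complex.ofReal_injective e2
  obtain ⟨t, ht, hpos, hle⟩ := exists_prod_inv_le_exp lam h0 h1 hp hpτ hτ rfl (hsum.le.trans htr)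
  set A : Set (Hilb ι) := {x | τ * ‖x‖ ^ 2 ≤ ‖F x‖ ^ 2}
  have hFc : Continuous F := LinearMap.continuous_of_finiteDimensional F
  have hA : MeasurableSet A := measurableSet_le (by fun_prop) (by fun_prop)
  have hcone : ∀ (r : ℝ) (x : Hilb ι), 0 < r → (r • x ∈ A ↔ x ∈ A) := by
    intro r x hr
    have e : F (r • x) = r • F x := by simp
    simp only [A, Set.mem_ofPred_eq, e, norm_smul, mul_pow, Real.norm_eq_abs, sq_abs]
    rw [mul_left_comm]
    exact mul_le_mul_iff_right₀ (by positivity)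
  have hset : {ψ : PureState ι | τ ≤ ‖F ψ‖ ^ 2} = {ψ : PureState ι | (ψ : Hilb ι) ∈ A} := by
    ext ψ
    simp [A]
  -- The Gaussian tilted by exp(t(‖Fx‖² - τ‖x‖²)) remains diagonal in the eigenbasis of F*F.
  have hpt : ∀ x : Hilb ι, -∑ i, (1 - t * (lam i - τ)) * ‖b.repr x i‖ ^ 2 =
      -‖x‖ ^ 2 + t * (‖F x‖ ^ 2 - τ * ‖x‖ ^ 2) := by
    intro x
    have hx : ‖x‖ ^ 2 = ∑ i, ‖b.repr x i‖ ^ 2 := by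
      rw [← b.repr.norm_map, EuclideanSpace.norm_sq_eq]
    rw [hquad, hx, Finset.mul_sum, ← Finset.sum_neg_distrib, ← Finset.sum_neg_distrib,
      ← Finset.sum_sub_distrib, Finset.mul_sum, ← Finset.sum_add_distrib]
    exact Finset.sum_congr rfl fun i _ => by ring
  have hmain : haarState ι {ψ | (ψ : Hilb ι) ∈ A} *
      ∫⁻ x : Hilb ι, ENNReal.ofReal (Real.exp (-‖x‖ ^ 2)) ≤
      ENNReal.ofReal (Real.exp (-(Fintype.card ι * (τ - p) ^ 2))) *
      ∫⁻ x : Hilb ι, ENNReal.ofReal (Real.exp (-‖x‖ ^ 2)) := by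
    rw [← setLIntegral_gaussian_cone A hA hcone]
    -- Markov's inequality: the tilt is at least 1 on the cone.
    calc _ ≤ ∫⁻ x in A, ENNReal.ofReal
          (Real.exp (-∑ i, (1 - t * (lam i - τ)) * ‖b.repr x i‖ ^ 2)) := by
          refine setLIntegral_mono' hA fun x hx => ?_
          rw [hpt]
          gcongr
          have : 0 ≤ t * (‖F x‖ ^ 2 - τ * ‖x‖ ^ 2) := mul_nonneg ht (sub_nonneg.2 hx)
          linarith
      _ ≤ ∫⁻ x : Hilb ι, ENNReal.ofReal
          (Real.exp (-∑ i, (1 - t * (lam i - τ)) * ‖b.repr x i‖ ^ 2)) := setLIntegral_le_lintegral _ _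
      _ = _ := lintegral_gaussian_diagonal b _ hpos
      _ ≤ _ := by gcongr
  rw [hset]
  exact (ENNReal.mul_le_mul_iff_left (lintegral_gaussian_ne_zero ι)
    (lintegral_gaussian_ne_top ι)).1 hmain

/-! ### Nets in the unit ball. -/

/-- Volumetric bound for the size of a separated subset of the unit ball. -/
theorem card_le_of_separated_unitBall {E : Type*} [NormedAddCommGroup E] [NormedSpace ℝ E]
    [FiniteDimensional ℝ E] (s : Finset E) {ε : ℝ} (hε : 0 < ε) (hs : ∀ x ∈ s, ‖x‖ ≤ 1)
    (hsep : ∀ x ∈ s, ∀ y ∈ s, x ≠ y → ε ≤ ‖x - y‖) :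
    (s.card : ℝ) ≤ (1 + 2 / ε) ^ Module.finrank ℝ E := by
  borelize E
  let μ : Measure E := Measure.addHaar
  have hD : Set.Pairwise (s : Set E)
      (Function.onFun Disjoint fun c => Metric.ball (c : E) (ε / 2)) := by
    rintro c hc d hd hcd
    apply Metric.ball_disjoint_ball
    rw [dist_eq_norm]
    linarith [hsep c hc d hd hcd]
  have hsub : (⋃ c ∈ s, Metric.ball (c : E) (ε / 2)) ⊆ Metric.ball (0 : E) (1 + ε / 2) := by
    refine Set.iUnion₂_subset fun x hx => Metric.ball_subset_ball' ?_
    rw [dist_zero_right]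
    linarith [hs x hx]
  have hI : (s.card : ENNReal) * ENNReal.ofReal ((ε / 2) ^ Module.finrank ℝ E) *
      μ (Metric.ball 0 1) ≤
      ENNReal.ofReal ((1 + ε / 2) ^ Module.finrank ℝ E) * μ (Metric.ball 0 1) := by
    calc _ = μ (⋃ c ∈ s, Metric.ball (c : E) (ε / 2)) := by
          rw [measure_biUnion_finset hD fun c _ => measurableSet_ball]
          simp only [μ.addHaar_ball_of_pos _ (half_pos hε), Finset.sum_const, nsmul_eq_mul,
            mul_assoc]
      _ ≤ μ (Metric.ball (0 : E) (1 + ε / 2)) := measure_mono hsub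
      _ = _ := μ.addHaar_ball_of_pos _ (by positivity)
  have hJ := (ENNReal.mul_le_mul_iff_left (Metric.measure_ball_pos μ _ zero_lt_one).ne'
    measure_ball_lt_top.ne).1 hI
  have hK := ENNReal.toReal_le_of_le_ofReal (by positivity) hJ
  rw [ENNReal.toReal_mul, ENNReal.toReal_natCast, ENNReal.toReal_ofReal (by positivity)] at hK
  have e : 1 + 2 / ε = (1 + ε / 2) / (ε / 2) := by field_simp; ring
  rwa [e, div_pow, le_div_iff₀ (by positivity)]

/-- A subset of the unit ball has a finite net of controlled size consisting of its own points. -/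
theorem exists_finset_net {E : Type*} [NormedAddCommGroup E] [NormedSpace ℝ E]
    [FiniteDimensional ℝ E] (A : Set E) (hA : ∀ x ∈ A, ‖x‖ ≤ 1) {ε : ℝ} (hε : 0 < ε) :
    ∃ s : Finset E, (∀ x ∈ s, x ∈ A) ∧ (∀ x ∈ A, ∃ y ∈ s, ‖x - y‖ ≤ ε) ∧
      (s.card : ℝ) ≤ (1 + 2 / ε) ^ Module.finrank ℝ E := by
  classical
  let P : Finset E → Prop := fun s => (∀ x ∈ s, x ∈ A) ∧ ∀ x ∈ s, ∀ y ∈ s, x ≠ y → ε ≤ ‖x - y‖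
  have hbound : ∀ s, P s → (s.card : ℝ) ≤ (1 + 2 / ε) ^ Module.finrank ℝ E := fun s hs =>
    card_le_of_separated_unitBall s hε (fun x hx => hA x (hs.1 x hx)) hs.2
  -- A separated set of largest cardinality exists by the volume bound; any point far from it could
  -- be added, so it is a net.
  let N : Set ℕ := {n | ∃ s, P s ∧ s.card = n}
  have hN0 : N.Nonempty := ⟨0, ∅, by simp [P], rfl⟩
  have hNb : BddAbove N := by
    refine ⟨⌊(1 + 2 / ε) ^ Module.finrank ℝ E⌋₊, ?_⟩
    rintro _ ⟨s, hs, rfl⟩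
    exact Nat.le_floor (hbound s hs)
  obtain ⟨s, hs, hcard⟩ := Nat.sSup_mem hN0 hNb
  refine ⟨s, hs.1, fun x hx => ?_, hbound s hs⟩
  by_contra! h
  have hxs : x ∉ s := fun hxs => by
    have := h x hxs
    rw [sub_self, norm_zero] at this
    linarith
  have hP : P (insert x s) := by
    refine ⟨fun y hy => ?_, fun y hy z hz hyz => ?_⟩
    · rcases Finset.mem_insert.1 hy with rfl | hy
      exacts [hx, hs.1 y hy]
    · rcases Finset.mem_insert.1 hy with hy' | hy' <;>
        rcases Finset.mem_insert.1 hz with hz' | hz'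
      · exact absurd (hy'.trans hz'.symm) hyz
      · rw [hy']
        exact (h z hz').le
      · rw [norm_sub_rev, hz']
        exact (h y hy').le
      · exact hs.2 y hy' z hz' hyz
  have := le_csSup hNb ⟨insert x s, hP, rfl⟩
  rw [Finset.card_insert_of_notMem hxs] at this
  omega

/-! ### Reducing the number of Kraus operators. -/

/-- A sesquilinear form evaluated on a unitary mixture of a family of vectors. -/
theorem sum_smul_sesq_mix {ι M W : Type*} [Fintype ι] [DecidableEq ι] [AddCommGroup M] [Module ℂ M]
    [AddCommGroup W] [Module ℂ W] (B : M →ₗ⋆[ℂ] M →ₗ[ℂ] W) (U : Matrix ι ι ℂ) (c : ι → ℂ)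
    (K : ι → M) :
    ∑ j, c j • B (∑ l, star (U l j) • K l) (∑ l, star (U l j) • K l) =
      ∑ k, ∑ l, (U * Matrix.diagonal c * U.conjTranspose) k l • B (K k) (K l) := by
  simp only [map_sum, LinearMap.map_smulₛₗ, LinearMap.sum_apply, LinearMap.smul_apply,
    Finset.smul_sum, Matrix.mul_apply (N := U.conjTranspose), Matrix.mul_diagonal, Finset.sum_smul,
    Matrix.conjTranspose_apply, smul_smul, RingHom.id_apply]
  rw [Finset.sum_comm]
  conv_lhs => enter [2, k]; rw [Finset.sum_comm]
  rw [Finset.sum_comm]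
  refine Finset.sum_congr rfl fun k _ => Finset.sum_congr rfl fun l _ =>
    Finset.sum_congr rfl fun j _ => ?_
  congr 1
  simp
  ring

/-- Among more than `|a|` matrices with `a` columns, the products `Kₖᴴ Kₗ` satisfy a linear relation
with Hermitian coefficients. -/
theorem exists_hermitian_relation {q a ι : Type*} [Fintype q] [Fintype a] [DecidableEq a]
    [Fintype ι] [DecidableEq ι] (K : ι → Matrix q a ℂ) (h : Fintype.card a < Fintype.card ι) :
    ∃ D : Matrix ι ι ℂ, D.IsHermitian ∧ D ≠ 0 ∧
      ∑ k, ∑ l, D k l • ((K k).conjTranspose * K l) = 0 := by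
  let S : Matrix ι ι ℂ →ₗ[ℂ] Matrix a a ℂ :=
    { toFun := fun D => ∑ k, ∑ l, D k l • ((K k).conjTranspose * K l)
      map_add' := fun D D' => by simp [add_smul, Finset.sum_add_distrib]
      map_smul' := fun r D => by simp [Finset.smul_sum, smul_smul] }
  have hstar : ∀ D, S D.conjTranspose = (S D).conjTranspose := by
    intro D
    simp only [S, LinearMap.coe_mk, AddHom.coe_mk, Matrix.conjTranspose_sum,
      Matrix.conjTranspose_smul, Matrix.conjTranspose_mul, Matrix.conjTranspose_conjTranspose,
      Matrix.conjTranspose_apply]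
    rw [Finset.sum_comm]
  have hdim : Module.finrank ℂ (Matrix a a ℂ) < Module.finrank ℂ (Matrix ι ι ℂ) := by
    simp only [Module.finrank_matrix, Module.finrank_self, mul_one]
    exact Nat.mul_lt_mul'' h h
  obtain ⟨D, hD, hD0⟩ := Submodule.exists_mem_ne_zero_of_ne_bot
    (LinearMap.ker_ne_bot_of_finrank_lt (f := S) hdim)
  rw [LinearMap.mem_ker] at hD
  have hD' : S D.conjTranspose = 0 := by rw [hstar, hD, Matrix.conjTranspose_zero]
  -- The kernel of S is closed under adjoints, so it contains D + D*. If this vanishes, D is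
  -- anti-Hermitian and iD serves instead.
  by_cases h0 : D + D.conjTranspose = 0
  · refine ⟨Complex.I • D, ?_, ?_, ?_⟩
    · rw [Matrix.IsHermitian, Matrix.conjTranspose_smul, eq_neg_of_add_eq_zero_right h0]
      simp
    · simpa using hD0
    · change S (Complex.I • D) = 0
      rw [map_smul, hD, smul_zero]
  · refine ⟨D + D.conjTranspose, Matrix.isHermitian_add_transpose_self D, h0, ?_⟩
    change S (D + D.conjTranspose) = 0
    rw [map_add, hD, hD', add_zero]

/-- If nonnegative quantities are perturbed along a direction `lam`, the perturbation can be continued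
until one of the weights vanishes. -/
theorem exists_weights {ι : Type*} [Fintype ι] (lam g : ι → ℝ) (hneg : ∃ j, lam j < 0)
    (hg : 0 ≤ ∑ j, lam j * g j) :
    ∃ (t : ℝ) (j₀ : ι), (∀ j, 0 ≤ 1 + t * lam j) ∧ 1 + t * lam j₀ = 0 ∧
      ∑ j, g j ≤ ∑ j, (1 + t * lam j) * g j := by
  obtain ⟨j₁, hj₁⟩ := hneg
  obtain ⟨j₀, -, hj₀⟩ := Finset.exists_min_image Finset.univ lam ⟨j₁, Finset.mem_univ _⟩
  have hlt : lam j₀ < 0 := (hj₀ j₁ (Finset.mem_univ _)).trans_lt hj₁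
  have ht : 0 < -(lam j₀)⁻¹ := neg_pos.2 (inv_neg''.2 hlt)
  -- The weight at the most negative `lam j₀` is the first to reach zero.
  refine ⟨-(lam j₀)⁻¹, j₀, fun j => ?_, ?_, ?_⟩
  · have h1 := mul_le_mul_of_nonneg_left (hj₀ j (Finset.mem_univ _)) ht.le
    have h2 : -(lam j₀)⁻¹ * lam j₀ = -1 := by
      rw [neg_mul, inv_mul_cancel₀ hlt.ne]
    linarith
  · rw [neg_mul, inv_mul_cancel₀ hlt.ne, add_neg_cancel]
  · have : ∑ j, (1 + -(lam j₀)⁻¹ * lam j) * g j =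
        ∑ j, g j + -(lam j₀)⁻¹ * ∑ j, lam j * g j := by
      rw [Finset.mul_sum, ← Finset.sum_add_distrib]
      exact Finset.sum_congr rfl fun j _ => by ring
    rw [this]
    have := mul_nonneg ht.le hg
    linarith

section Reduction

variable {q a σ G : Type} [Fintype q] [Fintype a] [DecidableEq a] [Fintype σ]
  [NormedAddCommGroup G] [InnerProductSpace ℂ G]

/-- One Kraus operator can be removed from a family with more than `|a|` members without decreasing a
given positive semidefinite quadratic objective. -/
theorem exists_kraus_pred (T : σ → Matrix q a ℂ →ₗ[ℂ] G) {n : ℕ}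
    (K : Fin (n + 1) → Matrix q a ℂ) (hn : Fintype.card a < n + 1) :
    ∃ K' : Fin n → Matrix q a ℂ,
      ∑ k, (K' k).conjTranspose * K' k = ∑ k, (K k).conjTranspose * K k ∧
      ∑ k, ∑ s, ‖T s (K k)‖ ^ 2 ≤ ∑ k, ∑ s, ‖T s (K' k)‖ ^ 2 := by
  obtain ⟨D, hD, hD0, hrel⟩ := exists_hermitian_relation K (by simpa using hn)
  set g : Matrix q a ℂ → ℝ := fun X => ∑ s, ‖T s X‖ ^ 2 with hgdef
  let B₁ : Matrix q a ℂ →ₗ⋆[ℂ] Matrix q a ℂ →ₗ[ℂ] Matrix a a ℂ :=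
    LinearMap.mk₂'ₛₗ (starRingEnd ℂ) (RingHom.id ℂ) (fun X Y => X.conjTranspose * Y)
      (fun X X' Y => by simp [Matrix.add_mul]) (fun r X Y => by simp)
      (fun X Y Y' => by simp [Matrix.mul_add]) (fun r X Y => by simp)
  let B₂ : Matrix q a ℂ →ₗ⋆[ℂ] Matrix q a ℂ →ₗ[ℂ] ℂ :=
    LinearMap.mk₂'ₛₗ (starRingEnd ℂ) (RingHom.id ℂ) (fun X Y => ∑ s, inner ℂ (T s X) (T s Y))
      (fun X X' Y => by simp [Finset.sum_add_distrib])
      (fun r X Y => by simp [Finset.mul_sum, mul_comm])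
      (fun X Y Y' => by simp [Finset.sum_add_distrib])
      (fun r X Y => by simp [Finset.mul_sum])
  have hB₂ : ∀ X, B₂ X X = (g X : ℂ) := by
    intro X
    simp only [B₂, hgdef, LinearMap.mk₂'ₛₗ_apply, Complex.ofReal_sum]
    refine Finset.sum_congr rfl fun s _ => ?_
    rw [inner_self_eq_norm_sq_to_K]
    push_cast
    rfl
  set U : Matrix (Fin (n + 1)) (Fin (n + 1)) ℂ := hD.eigenvectorUnitary.1 with hU
  set lam := hD.eigenvalues with hlam
  have hUU : U * U.conjTranspose = 1 := Unitary.mul_star_self_of_mem hD.eigenvectorUnitary.2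
  have hspec : U * Matrix.diagonal (fun j => (lam j : ℂ)) * U.conjTranspose = D := by
    conv_rhs => rw [hD.spectral_theorem]
    rfl
  -- Mixing by the eigenvectors of D changes neither the completeness sum nor the objective, and
  -- makes the relation diagonal.
  set L : Fin (n + 1) → Matrix q a ℂ := fun j => ∑ l, star (U l j) • K l with hL
  have hone : ∀ {W : Type} [AddCommGroup W] [Module ℂ W]
      (B : Matrix q a ℂ →ₗ⋆[ℂ] Matrix q a ℂ →ₗ[ℂ] W),
      ∑ j, B (L j) (L j) = ∑ k, B (K k) (K k) := by
    intro W _ _ B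
    have h := sum_smul_sesq_mix B U 1 K
    have h1 : Matrix.diagonal (1 : Fin (n + 1) → ℂ) = 1 := Matrix.diagonal_one
    rw [h1, mul_one, hUU] at h
    simp only [Pi.one_apply, one_smul] at h
    rw [h]
    simp [Matrix.one_apply]
  have hL₁ : ∑ j, (L j).conjTranspose * L j = ∑ k, (K k).conjTranspose * K k := hone B₁
  have hLg : ∑ j, g (L j) = ∑ k, g (K k) := by
    have h := hone B₂
    simp_rw [hB₂] at h
    exact_mod_cast h
  have hLrel : ∑ j, (lam j : ℂ) • ((L j).conjTranspose * L j) = 0 := by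
    have h := sum_smul_sesq_mix B₁ U (fun j => (lam j : ℂ)) K
    rw [hspec] at h
    exact h.trans hrel
  have hlam0 : ∃ j, lam j ≠ 0 := by
    by_contra! h
    exact hD0 (hD.eigenvalues_eq_zero_iff.1 (funext h))
  -- Reweight by √w and drop index `j₀`, which contributes nothing because its weight or its
  -- operator is zero.
  have hfinish : ∀ (w : Fin (n + 1) → ℝ) (j₀ : Fin (n + 1)), (∀ j, 0 ≤ w j) →
      (w j₀ = 0 ∨ L j₀ = 0) →
      ∑ j, (w j : ℂ) • ((L j).conjTranspose * L j) = ∑ j, (L j).conjTranspose * L j →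
      ∑ j, g (L j) ≤ ∑ j, w j * g (L j) →
      ∃ K' : Fin n → Matrix q a ℂ,
        ∑ k, (K' k).conjTranspose * K' k = ∑ k, (K k).conjTranspose * K k ∧
        ∑ k, g (K k) ≤ ∑ k, g (K' k) := by
    intro w j₀ hw hzero hsum hobj
    refine ⟨fun i => ((Real.sqrt (w (j₀.succAbove i)) : ℝ) : ℂ) • L (j₀.succAbove i), ?_, ?_⟩
    · rw [← hL₁, ← hsum, Fin.sum_univ_succAbove _ j₀]
      have hz : (w j₀ : ℂ) • ((L j₀).conjTranspose * L j₀) = 0 := by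
        rcases hzero with h | h <;> simp [h]
      rw [hz, zero_add]
      refine Finset.sum_congr rfl fun i _ => ?_
      rw [Matrix.conjTranspose_smul, Matrix.smul_mul, Matrix.mul_smul, smul_smul]
      congr 1
      rw [Complex.star_def, Complex.conj_ofReal, ← Complex.ofReal_mul,
        Real.mul_self_sqrt (hw _)]
    · rw [← hLg]
      refine hobj.trans ?_
      rw [Fin.sum_univ_succAbove _ j₀]
      have hz : w j₀ * g (L j₀) = 0 := by
        rcases hzero with h | h <;> simp [h, hgdef]
      rw [hz, zero_add]
      refine le_of_eq (Finset.sum_congr rfl fun i _ => ?_)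
      simp only [hgdef, map_smul, norm_smul, mul_pow, Complex.norm_real, Real.norm_eq_abs, sq_abs,
        Real.sq_sqrt (hw _), Finset.mul_sum]
  have hmain : ∀ mu : Fin (n + 1) → ℝ, (∃ j, mu j ≠ 0) →
      ∑ j, (mu j : ℂ) • ((L j).conjTranspose * L j) = 0 → 0 ≤ ∑ j, mu j * g (L j) →
      ∃ K' : Fin n → Matrix q a ℂ,
        ∑ k, (K' k).conjTranspose * K' k = ∑ k, (K k).conjTranspose * K k ∧
        ∑ k, g (K k) ≤ ∑ k, g (K' k) := by
    intro mu hmu hmurel hmug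
    by_cases hneg : ∃ j, mu j < 0
    · obtain ⟨t, j₀, ht, htj, hobj⟩ := exists_weights mu (fun j => g (L j)) hneg hmug
      refine hfinish (fun j => 1 + t * mu j) j₀ ht (Or.inl htj) ?_ hobj
      have : ∀ j, ((1 + t * mu j : ℝ) : ℂ) • ((L j).conjTranspose * L j) =
          (L j).conjTranspose * L j + (t : ℂ) • ((mu j : ℂ) • ((L j).conjTranspose * L j)) := by
        intro j
        push_cast
        rw [add_smul, one_smul, smul_smul]
      simp_rw [this]
      rw [Finset.sum_add_distrib, ← Finset.smul_sum, hmurel, smul_zero, add_zero]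
    -- Without negative weights the trace of the relation is a vanishing sum of nonnegative terms,
    -- so an operator of nonzero weight is itself zero.
    · push Not at hneg
      obtain ⟨j₀, hj₀⟩ := hmu
      have htr := congrArg Matrix.trace hmurel
      rw [Matrix.trace_sum, Matrix.trace_zero] at htr
      have hterm : ∀ j, Matrix.trace ((mu j : ℂ) • ((L j).conjTranspose * L j)) =
          ((mu j * ∑ i, ∑ u, ‖L j u i‖ ^ 2 : ℝ) : ℂ) := by
        intro j
        rw [Matrix.trace_smul, Matrix.trace]
        simp only [Matrix.diag_apply, Matrix.mul_apply, Matrix.conjTranspose_apply, smul_eq_mul]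
        push_cast
        congr 1
        refine Finset.sum_congr rfl fun i _ => Finset.sum_congr rfl fun u _ => ?_
        exact Complex.conj_mul' _
      simp_rw [hterm] at htr
      rw [← Complex.ofReal_sum, Complex.ofReal_eq_zero] at htr
      have h0 := (Finset.sum_eq_zero_iff_of_nonneg (fun j _ =>
        mul_nonneg (hneg j) (by positivity))).1 htr j₀ (Finset.mem_univ _)
      have h1 := (mul_eq_zero.1 h0).resolve_left hj₀
      have hLz : L j₀ = 0 := by
        ext u i
        have h2 := (Finset.sum_eq_zero_iff_of_nonneg (fun i _ => by positivity)).1 h1 i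
          (Finset.mem_univ _)
        have h3 := (Finset.sum_eq_zero_iff_of_nonneg (fun u _ => by positivity)).1 h2 u
          (Finset.mem_univ _)
        simpa using h3
      exact hfinish 1 j₀ (fun _ => zero_le_one) (Or.inr hLz) (by simp) (by simp)
  -- The objective is affine along the perturbation; the sign of the relation is chosen so that it
  -- does not decrease.
  rcases le_total 0 (∑ j, lam j * g (L j)) with h | h
  · exact hmain lam hlam0 hLrel h
  · refine hmain (fun j => -lam j) ?_ ?_ ?_
    · obtain ⟨j, hj⟩ := hlam0
      exact ⟨j, neg_ne_zero.2 hj⟩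
    · simp only [Complex.ofReal_neg, neg_smul, Finset.sum_neg_distrib, hLrel, neg_zero]
    · simp only [neg_mul, Finset.sum_neg_distrib]
      linarith

/-- A Kraus family can be replaced by one indexed by the input basis without decreasing a given
positive semidefinite quadratic objective. -/
theorem exists_kraus_card {ι : Type} [Fintype ι] (T : σ → Matrix q a ℂ →ₗ[ℂ] G)
    (K : ι → Matrix q a ℂ) :
    ∃ K' : a → Matrix q a ℂ,
      ∑ k, (K' k).conjTranspose * K' k = ∑ k, (K k).conjTranspose * K k ∧
      ∑ k, ∑ s, ‖T s (K k)‖ ^ 2 ≤ ∑ k, ∑ s, ‖T s (K' k)‖ ^ 2 := by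
  have hfin : ∀ (n : ℕ) (K : Fin n → Matrix q a ℂ), ∃ K' : a → Matrix q a ℂ,
      ∑ k, (K' k).conjTranspose * K' k = ∑ k, (K k).conjTranspose * K k ∧
      ∑ k, ∑ s, ‖T s (K k)‖ ^ 2 ≤ ∑ k, ∑ s, ‖T s (K' k)‖ ^ 2 := by
    intro n
    induction n with
    | zero => exact fun K => ⟨0, by simp, by simp⟩
    | succ n ih =>
      intro K
      by_cases hn : Fintype.card a < n + 1
      · obtain ⟨K₁, h1, h2⟩ := exists_kraus_pred T K hn
        obtain ⟨K₂, h3, h4⟩ := ih K₁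
        exact ⟨K₂, h3.trans h1, h2.trans h4⟩
      · obtain ⟨e⟩ : Nonempty (Fin (n + 1) ↪ a) :=
          Function.Embedding.nonempty_of_card_le (by simpa using hn)
        have hz : ∀ x ∉ Set.range e, Function.extend e K 0 x = 0 := fun x hx =>
          Function.extend_apply' _ _ _ hx
        refine ⟨Function.extend e K 0, (Fintype.sum_of_injective e e.injective _ _
          (fun x hx => ?_) fun i => ?_).symm, (Fintype.sum_of_injective e e.injective _ _
          (fun x hx => ?_) fun i => ?_).le⟩
        · simp [hz x hx]
        · rw [e.injective.extend_apply]
        · simp [hz x hx]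
        · rw [e.injective.extend_apply]
  let e := Fintype.equivFin ι
  obtain ⟨K', h1, h2⟩ := hfin _ (K ∘ e.symm)
  refine ⟨K', h1.trans (e.symm.sum_comp fun k => (K k).conjTranspose * K k), ?_⟩
  exact (e.symm.sum_comp fun k => ∑ s, ‖T s (K k)‖ ^ 2).symm.le.trans h2

end Reduction

/-! ### Kraus representations of channels. -/

theorem exists_star_mul_self_of_nonneg {A : Type*} [NonUnitalCStarAlgebra A] [PartialOrder A]
    [StarOrderedRing A] {x : A} (hx : 0 ≤ x) : ∃ b, x = star b * b :=
  CStarAlgebra.nonneg_iff_eq_star_mul_self.1 hx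

open scoped MatrixOrder Matrix.Norms.L2Operator in
/-- Every quantum channel has a Kraus representation. -/
theorem Channel.exists_kraus {a b : Type} [Fintype a] [DecidableEq a] [Nonempty a] [Fintype b]
    [DecidableEq b] (Φ : Channel a b) :
    ∃ (κ : Type) (_ : Fintype κ) (K : κ → Matrix b a ℂ),
      (∀ i j u v, Φ.lin (Matrix.single i j 1) u v = ∑ s, K s u i * star (K s v j)) ∧
      ∑ s, (K s).conjTranspose * K s = 1 := by
  classical
  let e := Fintype.equivFin a
  let i₀ : a := Classical.arbitrary a
  -- R has a single nonzero row, chosen so that R*R is the block matrix of all matrix units. Its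
  -- image under Φ is the Choi matrix, whose square-root factor B supplies the Kraus operators.
  let R : CStarMatrix (Fin (Fintype.card a)) (Fin (Fintype.card a)) (Matrix a a ℂ) :=
    CStarMatrix.ofMatrix (Matrix.of fun s j => if s = e i₀ then Matrix.single i₀ (e.symm j) 1 else 0)
  let M := star R * R
  have hM : 0 ≤ M := star_mul_self_nonneg R
  have hMent : ∀ i j, M (e i) (e j) = Matrix.single i j 1 := by
    intro i j
    simp only [M, CStarMatrix.mul_apply, CStarMatrix.star_apply, R, CStarMatrix.ofMatrix_apply,
      Matrix.of_apply]
    rw [Finset.sum_eq_single (e i₀)]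
    · simp [Matrix.star_eq_conjTranspose]
    · intro s _ hs
      simp [hs]
    · simp
  obtain ⟨B, hB⟩ := exists_star_mul_self_of_nonneg
    (Φ.map_cstarMatrix_nonneg' _ M hM)
  have hΦ : ∀ i j, Φ.lin (Matrix.single i j 1) = ∑ s, star (B s (e i)) * B s (e j) := by
    intro i j
    have h := congrFun (congrFun hB (e i)) (e j)
    rw [CStarMatrix.map_apply, hMent, CStarMatrix.mul_apply] at h
    simp only [CStarMatrix.star_apply] at h
    exact h
  let K : Fin (Fintype.card a) × b → Matrix b a ℂ := fun s =>
    Matrix.of fun u i => star (B s.1 (e i) s.2 u)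
  have hK : ∀ i j u v, Φ.lin (Matrix.single i j 1) u v = ∑ s, K s u i * star (K s v j) := by
    intro i j u v
    rw [hΦ, Matrix.sum_apply, Fintype.sum_prod_type]
    simp [K, Matrix.mul_apply, Matrix.star_eq_conjTranspose]
  refine ⟨_, inferInstance, K, hK, ?_⟩
  ext j i
  have htr : (Φ.lin (Matrix.single i j 1)).trace = (Matrix.single i j (1 : ℂ)).trace :=
    Φ.trace_map _
  rw [Matrix.trace] at htr
  simp only [Matrix.diag_apply, hK] at htr
  rw [Matrix.sum_apply]
  simp only [Matrix.mul_apply, Matrix.conjTranspose_apply]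
  rw [Finset.sum_comm]
  simp_rw [mul_comm (star _)]
  rw [htr]
  by_cases h : i = j
  · rw [h, Matrix.trace_single_eq_same, Matrix.one_apply_eq]
  · rw [Matrix.trace_single_eq_of_ne _ _ _ h, Matrix.one_apply_ne (Ne.symm h)]

/-! ### Fidelity in terms of Kraus operators. -/

/-- The amplitude, at the basis state `z` of the third system, of the maximally entangled component of
`(X ⊗ Y ⊗ 1) ψ`. -/
def overlap {q a b c : Type} [Fintype q] [Fintype a] [Fintype b] [Fintype c]
    (ψ : Hilb ((a × b) × c)) (X : Matrix q a ℂ) (Y : Matrix q b ℂ) (z : c) : ℂ :=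
  ((Real.sqrt (Fintype.card q) : ℝ) : ℂ)⁻¹ * ∑ u, ∑ i, ∑ j, X u i * Y u j * ψ ((i, j), z)

/-- The fidelity with the maximally entangled state reached by two local Kraus families. -/
def krausFidelity {q a b c κ ν : Type} [Fintype q] [Fintype a] [Fintype b] [Fintype c] [Fintype κ]
    [Fintype ν] (ψ : Hilb ((a × b) × c)) (K : κ → Matrix q a ℂ) (L : ν → Matrix q b ℂ) : ℝ :=
  ∑ k, ∑ l, ∑ z, ‖overlap ψ (K k) (L l) z‖ ^ 2

theorem eprState_apply (m : ℕ) (u v : Qubits m) :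
    eprState m (u, v) =
      if u = v then ((Real.sqrt (Fintype.card (Qubits m)) : ℝ) : ℂ)⁻¹ else 0 := by
  have hcard : (Fintype.card (Qubits m) : ℝ) = 2 ^ m := by simp [Qubits]
  rw [hcard]
  simp only [eprState, eprAmp]
  split_ifs with h
  · subst h
    simp only [if_true, Finset.prod_const, Finset.card_univ, Fintype.card_fin, inv_pow]
    rw [← Complex.ofReal_pow]
    congr 2
    rw [eq_comm, Real.sqrt_eq_iff_mul_self_eq (by positivity) (by positivity), ← mul_pow,
      Real.mul_self_sqrt (by norm_num)]
  · obtain ⟨i, hi⟩ := Function.ne_iff.1 h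
    exact Finset.prod_eq_zero (Finset.mem_univ i) (if_neg hi)

theorem trace_mul_eprProj (m : ℕ) (R : Matrix (Qubits m × Qubits m) (Qubits m × Qubits m) ℂ) :
    (R * eprProj m).trace =
      ((Fintype.card (Qubits m) : ℝ) : ℂ)⁻¹ * ∑ u, ∑ v, R (u, u) (v, v) := by
  have hs : ((Real.sqrt (Fintype.card (Qubits m)) : ℝ) : ℂ)⁻¹ *
      ((Real.sqrt (Fintype.card (Qubits m)) : ℝ) : ℂ)⁻¹ =
      ((Fintype.card (Qubits m) : ℝ) : ℂ)⁻¹ := by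
    rw [← mul_inv, ← Complex.ofReal_mul, Real.mul_self_sqrt (by positivity)]
  rw [Matrix.trace]
  simp only [Matrix.diag_apply, Matrix.mul_apply, eprProj, density, Matrix.of_apply,
    Fintype.sum_prod_type, eprState_apply, apply_ite star, star_zero, ite_mul, mul_ite, zero_mul,
    mul_zero, Finset.sum_ite_irrel, Finset.sum_const_zero, Finset.sum_ite_eq, Finset.mem_univ,
    if_true, Finset.mul_sum]
  refine Finset.sum_congr rfl fun u _ => Finset.sum_congr rfl fun v _ => ?_
  rw [star_inv₀, Complex.star_def, Complex.conj_ofReal, hs, mul_comm]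

/-- Kraus labels and the basis of C together index an environment; for each of its outcomes the
fidelity collects the squared modulus of one amplitude, summed over register and input labels. -/
theorem trace_tensorMap_reducedAB {a b c κ ν : Type} [Fintype a] [DecidableEq a] [Fintype b]
    [DecidableEq b] [Fintype c] [Fintype κ] [Fintype ν] {m : ℕ}
    (Φ : Matrix a a ℂ →ₗ[ℂ] Matrix (Qubits m) (Qubits m) ℂ)
    (Ψ : Matrix b b ℂ →ₗ[ℂ] Matrix (Qubits m) (Qubits m) ℂ)
    (K : κ → Matrix (Qubits m) a ℂ) (L : ν → Matrix (Qubits m) b ℂ)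
    (hK : ∀ i j u v, Φ (Matrix.single i j 1) u v = ∑ s, K s u i * star (K s v j))
    (hL : ∀ i j u v, Ψ (Matrix.single i j 1) u v = ∑ s, L s u i * star (L s v j))
    (ψ : PureState ((a × b) × c)) :
    (tensorMap Φ Ψ (reducedAB ψ) * eprProj m).trace =
      (krausFidelity (ψ : Hilb ((a × b) × c)) K L : ℂ) := by
  have hs : ∀ x : ℂ, ((‖((Real.sqrt (Fintype.card (Qubits m)) : ℝ) : ℂ)⁻¹ * x‖ ^ 2 : ℝ) : ℂ) =
      ((Fintype.card (Qubits m) : ℝ) : ℂ)⁻¹ * (x * star x) := by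
    intro x
    rw [norm_mul, mul_pow, norm_inv, Complex.norm_real, Real.norm_eq_abs, inv_pow, sq_abs,
      Real.sq_sqrt (by positivity), Complex.star_def, Complex.mul_conj']
    push_cast
    rfl
  rw [trace_mul_eprProj, krausFidelity]
  simp only [Complex.ofReal_sum, overlap, hs, ← Finset.mul_sum]
  congr 1
  simp only [tensorMap, Matrix.sum_apply, Matrix.smul_apply, Matrix.kroneckerMap_apply, hK, hL,
    reducedAB, partialTrace, density, Matrix.of_apply, smul_eq_mul]
  have hx : ∀ (k : κ) (l : ν) (z : c),
      (∑ u, ∑ i, ∑ j, K k u i * L l u j * (ψ : Hilb ((a × b) × c)) ((i, j), z)) =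
      ∑ u, ∑ p : a × b, K k u p.1 * L l u p.2 * (ψ : Hilb ((a × b) × c)) (p, z) := by
    intro k l z
    simp only [Fintype.sum_prod_type]
  let A : κ × ν × c → Qubits m × (a × b) → ℂ := fun t w =>
    K t.1 w.1 w.2.1 * L t.2.1 w.1 w.2.2 * (ψ : Hilb ((a × b) × c)) (w.2, t.2.2)
  have hA : ∀ (k : κ) (l : ν) (z : c),
      (∑ u, ∑ p : a × b, K k u p.1 * L l u p.2 * (ψ : Hilb ((a × b) × c)) (p, z)) =
      ∑ w, A (k, l, z) w := by
    intro k l z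
    simp only [A, Fintype.sum_prod_type]
  simp only [hx, hA]
  have hprod : ∀ f : κ × ν × c → ℂ, ∑ t, f t = ∑ k, ∑ l, ∑ z, f (k, l, z) := fun f => by
    simp only [Fintype.sum_prod_type]
  have hR : ∑ k, ∑ l, ∑ z, (∑ w, A (k, l, z) w) * star (∑ w, A (k, l, z) w) =
      ∑ t : κ × ν × c, ∑ w, ∑ w', A t w * star (A t w') := by
    rw [hprod]
    simp only [star_sum, Finset.sum_mul_sum]
  have hterm : ∀ (u v : Qubits m) (p q : a × b),
      (∑ z, (ψ : Hilb ((a × b) × c)) (p, z) * star ((ψ : Hilb ((a × b) × c)) (q, z))) *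
        ((∑ s, K s u p.1 * star (K s v q.1)) * ∑ s, L s u p.2 * star (L s v q.2)) =
      ∑ t : κ × ν × c, A t (u, p) * star (A t (v, q)) := by
    intro u v p q
    rw [mul_comm, Finset.sum_mul_sum, Finset.sum_mul, hprod]
    refine Finset.sum_congr rfl fun k _ => ?_
    rw [Finset.sum_mul]
    refine Finset.sum_congr rfl fun l _ => ?_
    rw [Finset.mul_sum]
    refine Finset.sum_congr rfl fun z _ => ?_
    simp only [A, star_mul']
    ring
  simp only [hterm]
  rw [hR]
  calc _ = ∑ w : Qubits m × (a × b), ∑ w' : Qubits m × (a × b), ∑ t : κ × ν × c,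
        A t w * star (A t w') := by
        rw [Fintype.sum_prod_type]
        refine Finset.sum_congr rfl fun u _ => ?_
        rw [Finset.sum_comm]
        refine Finset.sum_congr rfl fun p _ => ?_
        rw [Fintype.sum_prod_type]
    _ = _ := by
        rw [Finset.sum_comm]
        conv_lhs => enter [2, w']; rw [Finset.sum_comm]
        rw [Finset.sum_comm]
        refine Finset.sum_congr rfl fun t _ => Finset.sum_comm

/-- Discarding part of the registers does not decrease the fidelity: the discarded parts become
additional labels of the Kraus families. -/
theorem krausFidelity_le_discard {q q' r a b c κ ν : Type} [Fintype q] [Fintype q'] [Fintype r]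
    [Nonempty r] [Fintype a] [Fintype b] [Fintype c] [Fintype κ] [Fintype ν] (e : q × r ≃ q')
    (ψ : Hilb ((a × b) × c)) (K : κ → Matrix q' a ℂ) (L : ν → Matrix q' b ℂ) :
    krausFidelity ψ K L ≤
      krausFidelity ψ (fun s : κ × r => Matrix.of fun u i => K s.1 (e (u, s.2)) i)
        (fun s : ν × r => Matrix.of fun u i => L s.1 (e (u, s.2)) i) := by
  set K₁ : κ × r → Matrix q a ℂ := fun s => Matrix.of fun u i => K s.1 (e (u, s.2)) i
  set L₁ : ν × r → Matrix q b ℂ := fun s => Matrix.of fun u i => L s.1 (e (u, s.2)) i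
  have hr : (0 : ℝ) < Fintype.card r := by exact_mod_cast Fintype.card_pos
  have hcard : (Fintype.card q' : ℝ) = Fintype.card q * Fintype.card r := by
    rw [← Fintype.card_congr e, Fintype.card_prod]
    push_cast
    rfl
  have hsplit : ∀ k l z, overlap ψ (K k) (L l) z =
      ((Real.sqrt (Fintype.card r) : ℝ) : ℂ)⁻¹ * ∑ t, overlap ψ (K₁ (k, t)) (L₁ (l, t)) z := by
    intro k l z
    simp only [overlap]
    rw [← Finset.mul_sum, ← mul_assoc, hcard, Real.sqrt_mul (by positivity), ← e.sum_comp,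
      Fintype.sum_prod_type_right, Complex.ofReal_mul, mul_inv,
      mul_comm ((Real.sqrt (Fintype.card r) : ℝ) : ℂ)⁻¹]
    simp [K₁, L₁]
  -- Cauchy-Schwarz over the discarded label t cancels the factor 1/|r|. Pairs with unequal labels
  -- on the two sides are added later and only help.
  have hbound : ∀ k l z, ‖overlap ψ (K k) (L l) z‖ ^ 2 ≤
      ∑ t, ‖overlap ψ (K₁ (k, t)) (L₁ (l, t)) z‖ ^ 2 := by
    intro k l z
    rw [hsplit, norm_mul, mul_pow, norm_inv, Complex.norm_real, Real.norm_eq_abs, inv_pow, sq_abs,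
      Real.sq_sqrt hr.le, inv_mul_le_iff₀ hr]
    calc _ ≤ (∑ t, ‖overlap ψ (K₁ (k, t)) (L₁ (l, t)) z‖) ^ 2 := by
          gcongr
          exact norm_sum_le _ _
      _ ≤ _ := by simpa using sq_sum_le_card_mul_sum_sq (s := Finset.univ)
                    (f := fun t => ‖overlap ψ (K₁ (k, t)) (L₁ (l, t)) z‖)
  rw [krausFidelity, krausFidelity, Fintype.sum_prod_type]
  refine Finset.sum_le_sum fun k _ => ?_
  calc ∑ l, ∑ z, ‖overlap ψ (K k) (L l) z‖ ^ 2
      ≤ ∑ l, ∑ z, ∑ t, ‖overlap ψ (K₁ (k, t)) (L₁ (l, t)) z‖ ^ 2 :=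
        Finset.sum_le_sum fun l _ => Finset.sum_le_sum fun z _ => hbound k l z
    _ = ∑ t, ∑ l, ∑ z, ‖overlap ψ (K₁ (k, t)) (L₁ (l, t)) z‖ ^ 2 := by
        rw [Finset.sum_comm]
        conv_lhs => enter [2, z]; rw [Finset.sum_comm]
        rw [Finset.sum_comm]
        exact Finset.sum_congr rfl fun t _ => Finset.sum_comm
    _ ≤ ∑ t, ∑ s : ν × r, ∑ z, ‖overlap ψ (K₁ (k, t)) (L₁ s) z‖ ^ 2 := by
        refine Finset.sum_le_sum fun t _ => ?_
        rw [Fintype.sum_prod_type]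
        refine Finset.sum_le_sum fun l _ => ?_
        exact Finset.single_le_sum (f := fun t' => ∑ z, ‖overlap ψ (K₁ (k, t)) (L₁ (l, t')) z‖ ^ 2)
          (fun t' _ => by positivity) (Finset.mem_univ t)

theorem sum_conjTranspose_mul_self_discard {q q' r a κ : Type} [Fintype q] [Fintype q'] [Fintype r]
    [Fintype κ] (e : q × r ≃ q') (K : κ → Matrix q' a ℂ) :
    ∑ s : κ × r, (Matrix.of fun u i => K s.1 (e (u, s.2)) i : Matrix q a ℂ).conjTranspose *
      (Matrix.of fun u i => K s.1 (e (u, s.2)) i : Matrix q a ℂ) =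
    ∑ k, (K k).conjTranspose * K k := by
  ext i j
  rw [Fintype.sum_prod_type, Matrix.sum_apply, Matrix.sum_apply]
  refine Finset.sum_congr rfl fun k _ => ?_
  rw [Matrix.sum_apply]
  simp only [Matrix.mul_apply, Matrix.conjTranspose_apply, Matrix.of_apply]
  rw [← e.sum_comp, Fintype.sum_prod_type_right]

/-- The overlap as a linear function of the first Kraus operator. -/
def overlapLeft {q a b c : Type} [Fintype q] [Fintype a] [Fintype b] [Fintype c]
    (ψ : Hilb ((a × b) × c)) (Y : Matrix q b ℂ) (z : c) : Matrix q a ℂ →ₗ[ℂ] ℂ where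
  toFun X := overlap ψ X Y z
  map_add' X X' := by
    simp only [overlap, Matrix.add_apply, add_mul, Finset.sum_add_distrib, mul_add]
  map_smul' t X := by
    simp only [overlap, Matrix.smul_apply, smul_eq_mul, RingHom.id_apply, Finset.mul_sum]
    refine Finset.sum_congr rfl fun u _ => Finset.sum_congr rfl fun i _ =>
      Finset.sum_congr rfl fun j _ => ?_
    ring

/-- The overlap as a linear function of the second Kraus operator. -/
def overlapRight {q a b c : Type} [Fintype q] [Fintype a] [Fintype b] [Fintype c]
    (ψ : Hilb ((a × b) × c)) (X : Matrix q a ℂ) (z : c) : Matrix q b ℂ →ₗ[ℂ] ℂ where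
  toFun Y := overlap ψ X Y z
  map_add' Y Y' := by
    simp only [overlap, Matrix.add_apply, mul_add, add_mul, Finset.sum_add_distrib]
  map_smul' t Y := by
    simp only [overlap, Matrix.smul_apply, smul_eq_mul, RingHom.id_apply, Finset.mul_sum]
    refine Finset.sum_congr rfl fun u _ => Finset.sum_congr rfl fun i _ =>
      Finset.sum_congr rfl fun j _ => ?_
    ring

/-- Both Kraus families can be reduced to one operator per basis state of the input. -/
theorem exists_kraus_card_krausFidelity {q a b c κ ν : Type} [Fintype q] [Fintype a]
    [DecidableEq a] [Fintype b] [DecidableEq b] [Fintype c] [Fintype κ] [Fintype ν]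
    (ψ : Hilb ((a × b) × c)) (K : κ → Matrix q a ℂ) (L : ν → Matrix q b ℂ) :
    ∃ (K' : a → Matrix q a ℂ) (L' : b → Matrix q b ℂ),
      ∑ k, (K' k).conjTranspose * K' k = ∑ k, (K k).conjTranspose * K k ∧
      ∑ l, (L' l).conjTranspose * L' l = ∑ l, (L l).conjTranspose * L l ∧
      krausFidelity ψ K L ≤ krausFidelity ψ K' L' := by
  -- With one family fixed, the fidelity is a sum of squared linear functionals of the other, so the
  -- families are reduced in turn.
  obtain ⟨K', hK', h1⟩ := exists_kraus_card
    (fun s : ν × c => overlapLeft (a := a) ψ (L s.1) s.2) K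
  obtain ⟨L', hL', h2⟩ := exists_kraus_card
    (fun s : a × c => overlapRight (b := b) ψ (K' s.1) s.2) L
  refine ⟨K', L', hK', hL', ?_⟩
  simp only [Fintype.sum_prod_type] at h1 h2
  calc krausFidelity ψ K L ≤ krausFidelity ψ K' L := h1
    _ = ∑ l, ∑ k, ∑ z, ‖overlap ψ (K' k) (L l) z‖ ^ 2 := Finset.sum_comm
    _ ≤ ∑ l, ∑ k, ∑ z, ‖overlap ψ (K' k) (L' l) z‖ ^ 2 := h2
    _ = krausFidelity ψ K' L' := Finset.sum_comm

/-- If `m ≥ 1` pairs are distillable, then this is witnessed by small Kraus families with outputs in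
`m`-qubit registers. -/
theorem exists_kraus_of_le_distillableLO {a b c : Type} [Fintype a] [DecidableEq a] [Nonempty a]
    [Fintype b] [DecidableEq b] [Nonempty b] [Fintype c] {h : ℝ} {m : ℕ} (hm : m ≠ 0)
    (ψ : PureState ((a × b) × c)) (hψ : (m : ℕ∞) ≤ distillableLO h (reducedAB ψ)) :
    ∃ (K : a → Matrix (Qubits m) a ℂ) (L : b → Matrix (Qubits m) b ℂ),
      ∑ k, (K k).conjTranspose * K k = 1 ∧ ∑ l, (L l).conjTranspose * L l = 1 ∧
      h ^ 2 ≤ krausFidelity (ψ : Hilb ((a × b) × c)) K L := by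
  -- A supremum over no distillable m' would be 0, so m ≠ 0 is essential; otherwise m - 1 would
  -- bound the supremum.
  obtain ⟨m', hmm', ΦA, ΦB, hfid⟩ : ∃ m', m ≤ m' ∧ LODistillable h (reducedAB ψ) m' := by
    by_contra! hcon
    have hle : distillableLO h (reducedAB ψ) ≤ ((m - 1 : ℕ) : ℕ∞) := by
      refine iSup₂_le fun m' hm' => ?_
      have : m' < m := not_le.1 fun hle => hcon m' hle hm'
      exact_mod_cast Nat.le_sub_one_of_lt this
    have : m ≤ m - 1 := by exact_mod_cast hψ.trans hle
    omega
  obtain ⟨n, rfl⟩ := Nat.exists_eq_add_of_le hmm'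
  obtain ⟨κ, _, K, hK, hK1⟩ := ΦA.exists_kraus
  obtain ⟨ν, _, L, hL, hL1⟩ := ΦB.exists_kraus
  rw [trace_tensorMap_reducedAB ΦA.lin ΦB.lin K L hK hL ψ, Complex.ofReal_re] at hfid
  let e : Qubits m × Qubits n ≃ Qubits (m + n) := Fin.appendEquiv m n
  have h1 := krausFidelity_le_discard e (ψ : Hilb ((a × b) × c)) K L
  obtain ⟨K', L', hK', hL', h2⟩ := exists_kraus_card_krausFidelity (ψ : Hilb ((a × b) × c))
    (fun s : κ × Qubits n => (Matrix.of fun u i => K s.1 (e (u, s.2)) i : Matrix (Qubits m) a ℂ))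
    (fun s : ν × Qubits n => (Matrix.of fun u i => L s.1 (e (u, s.2)) i : Matrix (Qubits m) b ℂ))
  exact ⟨K', L', hK'.trans ((sum_conjTranspose_mul_self_discard e K).trans hK1),
    hL'.trans ((sum_conjTranspose_mul_self_discard e L).trans hL1), hfid.trans (h1.trans h2)⟩

/-! ### The overlap operator of two local isometries. -/

theorem finrank_real_clm (ι κ : Type) [Fintype ι] [Fintype κ] :
    Module.finrank ℝ (Hilb ι →L[ℂ] Hilb κ) = 2 * (Fintype.card ι * Fintype.card κ) := by
  rw [finrank_real_of_complex, ← (LinearMap.toContinuousLinearMap (𝕜 := ℂ) (E := Hilb ι)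
    (F' := Hilb κ)).finrank_eq, Module.finrank_linearMap, finrank_euclideanSpace,
    finrank_euclideanSpace]

instance finiteDimensional_real_clm (ι κ : Type) [Fintype ι] [Fintype κ] :
    FiniteDimensional ℝ (Hilb ι →L[ℂ] Hilb κ) := by
  have : FiniteDimensional ℂ (Hilb ι →L[ℂ] Hilb κ) :=
    Module.Finite.equiv (LinearMap.toContinuousLinearMap (𝕜 := ℂ) (E := Hilb ι) (F' := Hilb κ))
  exact Module.Finite.trans ℂ _

section Overlap

variable {q a b c κ ν : Type} [Fintype q] [Fintype a] [DecidableEq a] [Fintype b] [DecidableEq b]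
  [Fintype c] [Fintype κ] [Fintype ν]

/-- The Kraus operators obtained from an operator with values in `κ × q` by projecting the
environment `κ` onto its computational basis. -/
def opKraus (V : Hilb a →L[ℂ] Hilb (κ × q)) (k : κ) : Matrix q a ℂ :=
  Matrix.of fun u i => V (EuclideanSpace.single i 1) (k, u)

/-- The maximally entangled component of `(V ⊗ W ⊗ 1) ψ`. -/
def overlapMap (V : Hilb a →L[ℂ] Hilb (κ × q)) (W : Hilb b →L[ℂ] Hilb (ν × q)) :
    Hilb ((a × b) × c) →ₗ[ℂ] Hilb ((κ × ν) × c) where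
  toFun ψ := WithLp.toLp 2 fun t => overlap ψ (opKraus V t.1.1) (opKraus W t.1.2) t.2
  map_add' ψ φ := by
    ext t
    simp only [overlap, PiLp.add_apply, mul_add, Finset.sum_add_distrib]
  map_smul' r ψ := by
    ext t
    simp only [overlap, PiLp.smul_apply, smul_eq_mul, RingHom.id_apply, Finset.mul_sum]
    refine Finset.sum_congr rfl fun u _ => Finset.sum_congr rfl fun i _ =>
      Finset.sum_congr rfl fun j _ => ?_
    ring

theorem norm_sq_overlapMap (V : Hilb a →L[ℂ] Hilb (κ × q)) (W : Hilb b →L[ℂ] Hilb (ν × q))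
    (ψ : Hilb ((a × b) × c)) :
    ‖overlapMap V W ψ‖ ^ 2 = krausFidelity ψ (opKraus V) (opKraus W) := by
  rw [EuclideanSpace.norm_sq_eq, krausFidelity, Fintype.sum_prod_type, Fintype.sum_prod_type]
  rfl

theorem opKraus_sub (V V' : Hilb a →L[ℂ] Hilb (κ × q)) (k : κ) :
    opKraus (V - V') k = opKraus V k - opKraus V' k := by
  ext u i
  simp [opKraus]

/-- Telescoping by bilinearity in (V, W); it makes the fidelity Lipschitz in the protocol. -/
theorem overlapMap_sub_overlapMap (V V' : Hilb a →L[ℂ] Hilb (κ × q))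
    (W W' : Hilb b →L[ℂ] Hilb (ν × q)) (ψ : Hilb ((a × b) × c)) :
    overlapMap V W ψ - overlapMap V' W' ψ =
      overlapMap (V - V') W ψ + overlapMap V' (W - W') ψ := by
  ext t
  have h1 := (overlapLeft ψ (opKraus W t.1.2) t.2).map_sub (opKraus V t.1.1) (opKraus V' t.1.1)
  have h2 := (overlapRight ψ (opKraus V' t.1.1) t.2).map_sub (opKraus W t.1.2) (opKraus W' t.1.2)
  rw [← opKraus_sub] at h1 h2
  change overlap ψ (opKraus V t.1.1) (opKraus W t.1.2) t.2 -
      overlap ψ (opKraus V' t.1.1) (opKraus W' t.1.2) t.2 =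
    overlap ψ (opKraus (V - V') t.1.1) (opKraus W t.1.2) t.2 +
      overlap ψ (opKraus V' t.1.1) (opKraus (W - W') t.1.2) t.2
  change overlap ψ (opKraus (V - V') t.1.1) (opKraus W t.1.2) t.2 =
      overlap ψ (opKraus V t.1.1) (opKraus W t.1.2) t.2 -
      overlap ψ (opKraus V' t.1.1) (opKraus W t.1.2) t.2 at h1
  change overlap ψ (opKraus V' t.1.1) (opKraus (W - W') t.1.2) t.2 =
      overlap ψ (opKraus V' t.1.1) (opKraus W t.1.2) t.2 -
      overlap ψ (opKraus V' t.1.1) (opKraus W' t.1.2) t.2 at h2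
  rw [h1, h2]
  ring

theorem apply_eq_sum_opKraus (V : Hilb a →L[ℂ] Hilb (κ × q)) (x : Hilb a) (k : κ) (u : q) :
    V x (k, u) = ∑ i, opKraus V k u i * x i := by
  have hx : x = ∑ i, x i • EuclideanSpace.single i (1 : ℂ) := by
    ext j
    simp [Pi.single_apply]
  conv_lhs => rw [hx]
  simp [opKraus, mul_comm]

/-- Cauchy-Schwarz over the register label u cancels the normalization 1/|q|. Enlarging the diagonal
sum over equal register labels to all pairs then allows the norm bounds for W and V to be applied
successively. -/
theorem norm_overlapMap_le (V : Hilb a →L[ℂ] Hilb (κ × q)) (W : Hilb b →L[ℂ] Hilb (ν × q))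
    (ψ : Hilb ((a × b) × c)) : ‖overlapMap V W ψ‖ ≤ ‖V‖ * ‖W‖ * ‖ψ‖ := by
  rcases isEmpty_or_nonempty q with hq | hq
  · have : ‖overlapMap V W ψ‖ ^ 2 = 0 := by
      rw [norm_sq_overlapMap]
      simp [krausFidelity, overlap]
    rw [pow_eq_zero_iff two_ne_zero] at this
    rw [this]
    positivity
  have hq0 : (0 : ℝ) < Fintype.card q := by exact_mod_cast Fintype.card_pos
  let x : b → c → Hilb a := fun j z => WithLp.toLp 2 fun i => ψ ((i, j), z)
  let y : κ → q → c → Hilb b := fun k u z => WithLp.toLp 2 fun j => V (x j z) (k, u)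
  have hov : ∀ k l z, overlap ψ (opKraus V k) (opKraus W l) z =
      ((Real.sqrt (Fintype.card q) : ℝ) : ℂ)⁻¹ * ∑ u, W (y k u z) (l, u) := by
    intro k l z
    rw [overlap]
    congr 1
    refine Finset.sum_congr rfl fun u _ => ?_
    rw [apply_eq_sum_opKraus, Finset.sum_comm]
    refine Finset.sum_congr rfl fun j _ => ?_
    simp only [y]
    rw [apply_eq_sum_opKraus, Finset.mul_sum]
    refine Finset.sum_congr rfl fun i _ => ?_
    simp only [x]
    ring
  have hb : ∀ k l z, ‖overlap ψ (opKraus V k) (opKraus W l) z‖ ^ 2 ≤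
      ∑ u, ‖W (y k u z) (l, u)‖ ^ 2 := by
    intro k l z
    rw [hov, norm_mul, mul_pow, norm_inv, Complex.norm_real, Real.norm_eq_abs, inv_pow, sq_abs,
      Real.sq_sqrt hq0.le, inv_mul_le_iff₀ hq0]
    calc _ ≤ (∑ u, ‖W (y k u z) (l, u)‖) ^ 2 := by
          gcongr
          exact norm_sum_le _ _
      _ ≤ _ := by simpa using sq_sum_le_card_mul_sum_sq (s := Finset.univ)
                    (f := fun u => ‖W (y k u z) (l, u)‖)
  have hW : ∀ y : Hilb b, ∑ l, ∑ u, ‖W y (l, u)‖ ^ 2 ≤ ‖W‖ ^ 2 * ∑ j, ‖y j‖ ^ 2 := by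
    intro y
    have h := pow_le_pow_left₀ (norm_nonneg _) (W.le_opNorm y) 2
    rwa [mul_pow, EuclideanSpace.norm_sq_eq, EuclideanSpace.norm_sq_eq,
      Fintype.sum_prod_type] at h
  have hV : ∀ x : Hilb a, ∑ k, ∑ u, ‖V x (k, u)‖ ^ 2 ≤ ‖V‖ ^ 2 * ∑ i, ‖x i‖ ^ 2 := by
    intro x
    have h := pow_le_pow_left₀ (norm_nonneg _) (V.le_opNorm x) 2
    rwa [mul_pow, EuclideanSpace.norm_sq_eq, EuclideanSpace.norm_sq_eq,
      Fintype.sum_prod_type] at h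
  have hsq : ‖overlapMap V W ψ‖ ^ 2 ≤ (‖V‖ * ‖W‖ * ‖ψ‖) ^ 2 := by
    calc ‖overlapMap V W ψ‖ ^ 2
        = ∑ k, ∑ l, ∑ z, ‖overlap ψ (opKraus V k) (opKraus W l) z‖ ^ 2 :=
          norm_sq_overlapMap V W ψ
      _ ≤ ∑ k, ∑ l, ∑ z, ∑ u, ‖W (y k u z) (l, u)‖ ^ 2 :=
          Finset.sum_le_sum fun k _ => Finset.sum_le_sum fun l _ =>
            Finset.sum_le_sum fun z _ => hb k l z
      _ = ∑ z, ∑ k, ∑ u, ∑ l, ‖W (y k u z) (l, u)‖ ^ 2 := by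
          conv_rhs => rw [Finset.sum_comm]
          refine Finset.sum_congr rfl fun k _ => ?_
          rw [Finset.sum_comm]
          exact Finset.sum_congr rfl fun z _ => Finset.sum_comm
      _ ≤ ∑ z, ∑ k, ∑ u, ‖W‖ ^ 2 * ∑ j, ‖V (x j z) (k, u)‖ ^ 2 := by
          refine Finset.sum_le_sum fun z _ => Finset.sum_le_sum fun k _ =>
            Finset.sum_le_sum fun u _ => ?_
          refine le_trans ?_ (hW (y k u z))
          exact Finset.sum_le_sum fun l _ => Finset.single_le_sum
            (f := fun u' => ‖W (y k u z) (l, u')‖ ^ 2) (fun _ _ => by positivity)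
            (Finset.mem_univ u)
      _ = ‖W‖ ^ 2 * ∑ z, ∑ j, ∑ k, ∑ u, ‖V (x j z) (k, u)‖ ^ 2 := by
          simp only [← Finset.mul_sum]
          congr 1
          refine Finset.sum_congr rfl fun z _ => ?_
          conv_lhs => enter [2, k]; rw [Finset.sum_comm]
          rw [Finset.sum_comm]
      _ ≤ ‖W‖ ^ 2 * ∑ z, ∑ j, ‖V‖ ^ 2 * ∑ i, ‖ψ ((i, j), z)‖ ^ 2 := by
          gcongr with z _ j _
          exact hV (x j z)
      _ = (‖V‖ * ‖W‖ * ‖ψ‖) ^ 2 := by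
          rw [mul_pow, mul_pow, EuclideanSpace.norm_sq_eq, Fintype.sum_prod_type_right]
          simp only [Fintype.sum_prod_type_right, ← Finset.mul_sum]
          ring
  exact le_of_sq_le_sq hsq (by positivity)

end Overlap

section Isometry

variable {q a b c κ ν : Type} [Fintype q] [Fintype a] [DecidableEq a] [Fintype b] [DecidableEq b]
  [Fintype c] [Fintype κ] [Fintype ν]

/-- A complete Kraus family dilates to an isometry. -/
theorem exists_isometry_of_kraus (K : κ → Matrix q a ℂ)
    (hK : ∑ k, (K k).conjTranspose * K k = 1) :
    ∃ V : Hilb a →L[ℂ] Hilb (κ × q), (∀ x, ‖V x‖ = ‖x‖) ∧ opKraus V = K := by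
  classical
  let M : Matrix (κ × q) a ℂ := Matrix.of fun p i => K p.1 p.2 i
  have hM : M.conjTranspose * M = 1 := by
    rw [← hK]
    ext i j
    simp [M, Matrix.mul_apply, Matrix.sum_apply, Fintype.sum_prod_type]
  refine ⟨LinearMap.toContinuousLinearMap (Matrix.toEuclideanLin M), fun x => ?_, ?_⟩
  · have h : inner ℂ (Matrix.toEuclideanLin M x) (Matrix.toEuclideanLin M x) = inner ℂ x x := by
      rw [← LinearMap.adjoint_inner_left, ← Matrix.toEuclideanLin_conjTranspose_eq_adjoint,
        ← LinearMap.comp_apply, ← Matrix.toLpLin_mul, hM, Matrix.toLpLin_one, LinearMap.id_apply]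
    rw [inner_self_eq_norm_sq_to_K, inner_self_eq_norm_sq_to_K] at h
    have h2 : ‖Matrix.toEuclideanLin M x‖ ^ 2 = ‖x‖ ^ 2 := by exact_mod_cast h
    exact (sq_eq_sq₀ (norm_nonneg _) (norm_nonneg _)).1 h2
  · funext k
    ext u i
    simp [opKraus, M, Matrix.toLpLin_apply]

theorem sum_norm_sq_opKraus (V : Hilb a →L[ℂ] Hilb (κ × q)) (hV : ∀ x, ‖V x‖ = ‖x‖) :
    ∑ i, ∑ k, ∑ u, ‖opKraus V k u i‖ ^ 2 = Fintype.card a := by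
  have h : ∀ i, ∑ k, ∑ u, ‖opKraus V k u i‖ ^ 2 = 1 := by
    intro i
    have h := congrArg (· ^ 2) (hV (EuclideanSpace.single i 1))
    simp only [EuclideanSpace.norm_sq_eq (V _), Fintype.sum_prod_type] at h
    simpa [opKraus] using h
  simp [h]

/-- The Hilbert-Schmidt norm of the map extracting the maximally entangled component. -/
theorem sum_norm_sq_overlapMap_single_le [DecidableEq c] (V : Hilb a →L[ℂ] Hilb (κ × q))
    (W : Hilb b →L[ℂ] Hilb (ν × q)) (hV : ∀ x, ‖V x‖ = ‖x‖) (hW : ∀ x, ‖W x‖ = ‖x‖) :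
    ∑ p : (a × b) × c, ‖overlapMap V W (EuclideanSpace.single p 1)‖ ^ 2 ≤
      (Fintype.card q : ℝ)⁻¹ * Fintype.card ((a × b) × c) := by
  have hov : ∀ (p : (a × b) × c) k l z,
      overlap (EuclideanSpace.single p 1) (opKraus V k) (opKraus W l) z =
      if z = p.2 then ((Real.sqrt (Fintype.card q) : ℝ) : ℂ)⁻¹ *
        ∑ u, opKraus V k u p.1.1 * opKraus W l u p.1.2 else 0 := by
    rintro ⟨⟨i, j⟩, z'⟩ k l z
    simp only [overlap]
    by_cases h : z = z'
    · simp [h, ite_and, Finset.sum_ite_irrel]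
    · simp [h]
  have hterm : ∀ p : (a × b) × c, ‖overlapMap V W (EuclideanSpace.single p 1)‖ ^ 2 ≤
      (Fintype.card q : ℝ)⁻¹ * ((∑ k, ∑ u, ‖opKraus V k u p.1.1‖ ^ 2) *
        ∑ l, ∑ u, ‖opKraus W l u p.1.2‖ ^ 2) := by
    intro p
    rw [norm_sq_overlapMap, krausFidelity, Finset.sum_mul_sum, Finset.mul_sum]
    refine Finset.sum_le_sum fun k _ => ?_
    rw [Finset.mul_sum]
    refine Finset.sum_le_sum fun l _ => ?_
    simp only [hov, apply_ite norm, norm_zero, ite_pow, ne_eq, OfNat.ofNat_ne_zero,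
      not_false_eq_true, zero_pow, Finset.sum_ite_eq', Finset.mem_univ, if_true]
    rw [norm_mul, mul_pow, norm_inv, Complex.norm_real, Real.norm_eq_abs, inv_pow, sq_abs,
      Real.sq_sqrt (by positivity)]
    gcongr
    -- Cauchy-Schwarz over u decouples the two parties; 1/|q| survives as the bound on the mean
    -- fidelity.
    calc _ ≤ (∑ u, ‖opKraus V k u p.1.1‖ * ‖opKraus W l u p.1.2‖) ^ 2 := by
          gcongr
          refine (norm_sum_le _ _).trans_eq (Finset.sum_congr rfl fun u _ => norm_mul _ _)
      _ ≤ _ := Finset.sum_mul_sq_le_sq_mul_sq _ _ _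
  refine (Finset.sum_le_sum fun p _ => hterm p).trans_eq ?_
  rw [← Finset.mul_sum, Fintype.sum_prod_type, Fintype.sum_prod_type]
  simp only [Finset.sum_const, Finset.card_univ, nsmul_eq_mul, ← Finset.mul_sum]
  rw [← Finset.sum_mul, sum_norm_sq_opKraus V hV, sum_norm_sq_opKraus W hW]
  simp only [Fintype.card_prod]
  push_cast
  ring

theorem opNorm_le_one_of_isometry {E F : Type*} [NormedAddCommGroup E] [NormedSpace ℂ E]
    [NormedAddCommGroup F] [NormedSpace ℂ F] {V : E →L[ℂ] F} (hV : ∀ x, ‖V x‖ = ‖x‖) : ‖V‖ ≤ 1 :=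
  V.opNorm_le_bound zero_le_one fun x => by rw [hV, one_mul]

/-- For fixed local isometries, a Haar random state rarely has a large maximally entangled
component. -/
theorem haarState_overlapMap_tail [Nonempty a] [Nonempty b] [Nonempty c] [DecidableEq c]
    [Nonempty q] (V : Hilb a →L[ℂ] Hilb (κ × q)) (W : Hilb b →L[ℂ] Hilb (ν × q))
    (hV : ∀ x, ‖V x‖ = ‖x‖) (hW : ∀ x, ‖W x‖ = ‖x‖) {τ : ℝ}
    (hτ₀ : (Fintype.card q : ℝ)⁻¹ < τ) (hτ₁ : τ < 1) :
    haarState ((a × b) × c) {ψ | τ ≤ ‖overlapMap V W (ψ : Hilb ((a × b) × c))‖ ^ 2} ≤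
      ENNReal.ofReal (Real.exp
        (-(Fintype.card ((a × b) × c) * (τ - (Fintype.card q : ℝ)⁻¹) ^ 2))) := by
  have hq : (0 : ℝ) < Fintype.card q := by exact_mod_cast Fintype.card_pos
  refine haarState_sq_norm_tail (overlapMap V W) (fun x => ?_) (inv_pos.2 hq) hτ₀ hτ₁
    (sum_norm_sq_overlapMap_single_le V W hV hW)
  refine (norm_overlapMap_le V W x).trans ?_
  have h := mul_le_one₀ (opNorm_le_one_of_isometry hV) (norm_nonneg W)
    (opNorm_le_one_of_isometry hW)
  exact mul_le_of_le_one_left (norm_nonneg _) h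

/-- The norms differ by at most 2ε and sum to at most 2, whence 4ε. -/
theorem norm_sq_overlapMap_sub_le {V V' : Hilb a →L[ℂ] Hilb (κ × q)}
    {W W' : Hilb b →L[ℂ] Hilb (ν × q)} (hV : ‖V‖ ≤ 1) (hV' : ‖V'‖ ≤ 1) (hW : ‖W‖ ≤ 1)
    (hW' : ‖W'‖ ≤ 1) {ε : ℝ} (h₁ : ‖V - V'‖ ≤ ε) (h₂ : ‖W - W'‖ ≤ ε) {ψ : Hilb ((a × b) × c)}
    (hψ : ‖ψ‖ = 1) : ‖overlapMap V W ψ‖ ^ 2 - ‖overlapMap V' W' ψ‖ ^ 2 ≤ 4 * ε := by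
  have e1 := norm_overlapMap_le V W ψ
  have e2 := norm_overlapMap_le V' W' ψ
  have e3 := norm_overlapMap_le (V - V') W ψ
  have e4 := norm_overlapMap_le V' (W - W') ψ
  rw [hψ, mul_one] at e1 e2 e3 e4
  have f1 : ‖overlapMap V W ψ‖ ≤ 1 := e1.trans (mul_le_one₀ hV (norm_nonneg _) hW)
  have f2 : ‖overlapMap V' W' ψ‖ ≤ 1 := e2.trans (mul_le_one₀ hV' (norm_nonneg _) hW')
  have f3 : ‖overlapMap (V - V') W ψ‖ ≤ ε :=
    e3.trans ((mul_le_of_le_one_right (norm_nonneg _) hW).trans h₁)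
  have f4 : ‖overlapMap V' (W - W') ψ‖ ≤ ε :=
    e4.trans ((mul_le_of_le_one_left (norm_nonneg _) hV').trans h₂)
  have hd : ‖overlapMap V W ψ‖ - ‖overlapMap V' W' ψ‖ ≤ 2 * ε := by
    refine (norm_sub_norm_le _ _).trans ?_
    rw [overlapMap_sub_overlapMap]
    refine (norm_add_le _ _).trans ?_
    linarith
  have hε : 0 ≤ ε := (norm_nonneg _).trans h₁
  nlinarith [norm_nonneg (overlapMap V W ψ), norm_nonneg (overlapMap V' W' ψ)]

end Isometry

/-! ### Union bound and choice of constants. -/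

/-- The event that `m` pairs are distillable is covered by the events that the fidelity is large for
some pair of local isometries taken from two nets. -/
theorem exists_nets_cover (a b c : Type) [Fintype a] [DecidableEq a] [Nonempty a] [Fintype b]
    [DecidableEq b] [Nonempty b] [Fintype c] (h : ℝ) {m : ℕ} (hm : m ≠ 0) {ε : ℝ} (hε : 0 < ε) :
    ∃ (SA : Finset (Hilb a →L[ℂ] Hilb (a × Qubits m)))
      (SB : Finset (Hilb b →L[ℂ] Hilb (b × Qubits m))),
      (∀ V ∈ SA, ∀ x, ‖V x‖ = ‖x‖) ∧ (∀ W ∈ SB, ∀ x, ‖W x‖ = ‖x‖) ∧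
      (SA.card : ℝ) ≤ (1 + 2 / ε) ^ Module.finrank ℝ (Hilb a →L[ℂ] Hilb (a × Qubits m)) ∧
      (SB.card : ℝ) ≤ (1 + 2 / ε) ^ Module.finrank ℝ (Hilb b →L[ℂ] Hilb (b × Qubits m)) ∧
      {ψ : PureState ((a × b) × c) | (m : ℕ∞) ≤ distillableLO h (reducedAB ψ)} ⊆
        ⋃ V ∈ SA, ⋃ W ∈ SB,
          {ψ | h ^ 2 - 4 * ε ≤ ‖overlapMap V W (ψ : Hilb ((a × b) × c))‖ ^ 2} := by
  -- The net consists of isometries, as the tail bound for a fixed protocol requires.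
  obtain ⟨SA, hSA, hnetA, hcardA⟩ := exists_finset_net
    {V : Hilb a →L[ℂ] Hilb (a × Qubits m) | ∀ x, ‖V x‖ = ‖x‖}
    (fun V hV => opNorm_le_one_of_isometry hV) hε
  obtain ⟨SB, hSB, hnetB, hcardB⟩ := exists_finset_net
    {W : Hilb b →L[ℂ] Hilb (b × Qubits m) | ∀ x, ‖W x‖ = ‖x‖}
    (fun V hV => opNorm_le_one_of_isometry hV) hε
  refine ⟨SA, SB, hSA, hSB, hcardA, hcardB, fun ψ hψ => ?_⟩
  obtain ⟨K, L, hK, hL, hfid⟩ := exists_kraus_of_le_distillableLO hm ψ hψ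
  obtain ⟨V₀, hV₀, hVK⟩ := exists_isometry_of_kraus K hK
  obtain ⟨W₀, hW₀, hWL⟩ := exists_isometry_of_kraus L hL
  obtain ⟨V, hV, hVV⟩ := hnetA V₀ hV₀
  obtain ⟨W, hW, hWW⟩ := hnetB W₀ hW₀
  rw [← hVK, ← hWL, ← norm_sq_overlapMap] at hfid
  have hψ1 : ‖(ψ : Hilb ((a × b) × c))‖ = 1 := norm_eq_of_mem_sphere ψ
  have hV₀1 : ‖V₀‖ ≤ 1 := opNorm_le_one_of_isometry hV₀
  have hW₀1 : ‖W₀‖ ≤ 1 := opNorm_le_one_of_isometry hW₀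
  have hV1 : ‖V‖ ≤ 1 := opNorm_le_one_of_isometry (hSA V hV)
  have hW1 : ‖W‖ ≤ 1 := opNorm_le_one_of_isometry (hSB W hW)
  have hdist : ‖overlapMap V₀ W₀ (ψ : Hilb ((a × b) × c))‖ ^ 2 -
      ‖overlapMap V W (ψ : Hilb ((a × b) × c))‖ ^ 2 ≤ 4 * ε :=
    norm_sq_overlapMap_sub_le hV₀1 hV1 hW₀1 hW1 hVV hWW hψ1
  refine Set.mem_iUnion₂.2 ⟨V, hV, Set.mem_iUnion₂.2 ⟨W, hW, ?_⟩⟩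
  change h ^ 2 - 4 * ε ≤ _
  linarith

theorem card_qubits (n : ℕ) : Fintype.card (Qubits n) = 2 ^ n := by simp [Qubits]

/-- The comparison of the size of the nets with the error term of the theorem. -/
theorem net_exponent_le {c δ D M S : ℝ} (hc1 : c < 1) (hδ0 : 0 < δ)
    (hδM : δ ≤ 1 - M⁻¹) (hM : 1 ≤ M) (hD : 0 ≤ D) (hS : 0 ≤ S) :
    2 * M * S * (Real.log (1 + 8 / ((1 - c) / 2)) + Real.log (1 / δ)) -
        D * ((1 - (1 - c) / 2) * δ) ^ 2 ≤
      -c * δ ^ 2 * D +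
        2 * (1 + Real.log (1 + 8 / ((1 - c) / 2))) * (M ^ 2 * S * Real.log (1 / δ)) := by
  have hL : 0 ≤ Real.log (1 + 8 / ((1 - c) / 2)) := Real.log_nonneg (by
    have : 0 ≤ 8 / ((1 - c) / 2) := div_nonneg (by norm_num) (by linarith)
    linarith)
  set Lc := Real.log (1 + 8 / ((1 - c) / 2))
  set ℓ := Real.log (1 / δ) with hℓ
  have hM0 : 0 < M := by linarith
  -- log(1/δ) ≥ 1 - δ ≥ 1/M. Hence Mℓ ≥ 1, and one factor M absorbs the additive constant `Lc`.
  have h1 : M⁻¹ ≤ ℓ := by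
    have := Real.log_le_sub_one_of_pos hδ0
    rw [hℓ, one_div, Real.log_inv]
    linarith
  have h2 : 1 ≤ M * ℓ := by
    have := mul_le_mul_of_nonneg_left h1 hM0.le
    rwa [mul_inv_cancel₀ hM0.ne'] at this
  have hℓ0 : 0 ≤ ℓ := (inv_nonneg.2 hM0.le).trans h1
  have h3 : Lc + ℓ ≤ (1 + Lc) * (M * ℓ) := by
    have := mul_le_mul_of_nonneg_left h2 hL
    have := mul_le_mul_of_nonneg_right hM hℓ0
    linarith
  have h4 : 2 * M * S * (Lc + ℓ) ≤ 2 * (1 + Lc) * (M ^ 2 * S * ℓ) := by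
    calc _ ≤ 2 * M * S * ((1 + Lc) * (M * ℓ)) := by gcongr
      _ = _ := by ring
  have h5 : c ≤ (1 - (1 - c) / 2) ^ 2 := by nlinarith [sq_nonneg (1 - c)]
  have h6 : c * (δ ^ 2 * D) ≤ (1 - (1 - c) / 2) ^ 2 * (δ ^ 2 * D) := by gcongr
  linarith

/-- Local operations distil many EPR pairs from a Haar random tripartite state only with small
probability. -/
theorem exists_log_haarState_distillableLO_le (c : ℝ) (hc0 : 0 < c) (hc1 : c < 1) :
    ∃ K : ℝ, 0 < K ∧ ∀ (nA nB nC m : ℕ) (h δ : ℝ), 0 < h → h ≤ 1 →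
      δ = h ^ 2 - (2 : ℝ)⁻¹ ^ m → 0 < δ →
      ENNReal.log
        (haarState ((Qubits nA × Qubits nB) ×
            Qubits nC)
          {ψ | (m : ℕ∞) ≤ distillableLO h (reducedAB ψ)})
      ≤ ((-c * δ ^ 2 * (2 : ℝ) ^ (nA + nB + nC) +
          K * ((2 : ℝ) ^ (2 * m) * (((2 : ℝ) ^ nA) ^ 2 + ((2 : ℝ) ^ nB) ^ 2) * Real.log (1 / δ)) :
          ℝ) : EReal) := by
  have hκ : 0 < (1 - c) / 2 := by linarith
  have hκ1 : (1 - c) / 2 < 1 := by linarith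
  have hLc : 0 ≤ Real.log (1 + 8 / ((1 - c) / 2)) := Real.log_nonneg (by
    have : 0 ≤ 8 / ((1 - c) / 2) := by positivity
    linarith)
  refine ⟨2 * (1 + Real.log (1 + 8 / ((1 - c) / 2))), by positivity, ?_⟩
  intro nA nB nC m h δ hh0 hh1 hδ hδ0
  have hsq : h ^ 2 ≤ 1 := pow_le_one₀ hh0.le hh1
  -- For m = 0, δ = h² - 1 could not be positive.
  have hm : m ≠ 0 := by
    rintro rfl
    rw [pow_zero] at hδ
    linarith
  have hexp := net_exponent_le (c := c) (δ := δ) (D := (2 : ℝ) ^ (nA + nB + nC))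
    (M := (2 : ℝ) ^ m) (S := ((2 : ℝ) ^ nA) ^ 2 + ((2 : ℝ) ^ nB) ^ 2) hc1 hδ0
    (by rw [← inv_pow]; linarith) (one_le_pow₀ (by norm_num)) (by positivity) (by positivity)
  set κ := (1 - c) / 2
  have hp : ((Fintype.card (Qubits m) : ℝ))⁻¹ = (2 : ℝ)⁻¹ ^ m := by simp
  set p := (2 : ℝ)⁻¹ ^ m with hpdef
  have hp0 : 0 < p := by positivity
  set τ := p + (1 - κ) * δ with hτ
  have hκδ : 0 < κ * δ := mul_pos hκ hδ0
  have hκδ' : 0 < (1 - κ) * δ := mul_pos (by linarith) hδ0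
  have hτ1 : τ < 1 := by rw [hτ]; linarith
  -- The net costs 4ε = κδ of fidelity, leaving the excess (1 - κ)δ; κ = (1 - c)/2 makes (1 - κ)² ≥
  -- c.
  set ε := κ * δ / 4 with hε
  have hε0 : 0 < ε := by positivity
  have hδ1 : δ ≤ 1 := by linarith
  obtain ⟨SA, SB, hSA, hSB, hcardA, hcardB, hcover⟩ :=
    exists_nets_cover (Qubits nA) (Qubits nB) (Qubits nC) h hm hε0
  have hτε : h ^ 2 - 4 * ε = τ := by rw [hτ, hε]; linarith
  rw [hτε] at hcover
  set D : ℝ := (2 : ℝ) ^ (nA + nB + nC) with hD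
  have hcardD : (Fintype.card ((Qubits nA × Qubits nB) × Qubits nC) : ℝ) = D := by
    rw [Fintype.card_prod, Fintype.card_prod, card_qubits, card_qubits, card_qubits, hD, pow_add,
      pow_add]
    push_cast
    rfl
  have htail : ∀ V ∈ SA, ∀ W ∈ SB, haarState ((Qubits nA × Qubits nB) × Qubits nC)
      {ψ | τ ≤ ‖overlapMap V W (ψ : Hilb ((Qubits nA × Qubits nB) × Qubits nC))‖ ^ 2} ≤
      ENNReal.ofReal (Real.exp (-(D * ((1 - κ) * δ) ^ 2))) := by
    intro V hV W hW
    have ht := haarState_overlapMap_tail (c := Qubits nC) V W (hSA V hV) (hSB W hW) (τ := τ)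
      (by rw [hp]; linarith) hτ1
    rw [hp, hcardD] at ht
    have : τ - p = (1 - κ) * δ := by rw [hτ]; ring
    rwa [this] at ht
  have hbase : 1 + 2 / ε ≤ Real.exp (Real.log (1 + 8 / κ) + Real.log (1 / δ)) := by
    rw [Real.exp_add, Real.exp_log (by positivity), Real.exp_log (by positivity), hε]
    have e : (1 + 8 / κ) * (1 / δ) = 1 / δ + 2 / (κ * δ / 4) := by field_simp; ring
    rw [e]
    gcongr
    rw [le_div_iff₀ hδ0]
    linarith
  set ℓ := Real.log (1 + 8 / κ) + Real.log (1 / δ)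
  have hcard : ∀ (n : ℕ) (s : ℝ),
      s ≤ (1 + 2 / ε) ^ Module.finrank ℝ (Hilb (Qubits n) →L[ℂ] Hilb (Qubits n × Qubits m)) →
      s ≤ Real.exp (2 * 2 ^ m * ((2 : ℝ) ^ n) ^ 2 * ℓ) := by
    intro n s hs
    refine hs.trans ((pow_le_pow_left₀ (by positivity) hbase _).trans_eq ?_)
    rw [← Real.exp_nat_mul, finrank_real_clm, Fintype.card_prod, card_qubits, card_qubits]
    congr 1
    push_cast
    ring
  have hprob : haarState ((Qubits nA × Qubits nB) × Qubits nC)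
      {ψ | (m : ℕ∞) ≤ distillableLO h (reducedAB ψ)} ≤
      ENNReal.ofReal (Real.exp (2 * 2 ^ m * (((2 : ℝ) ^ nA) ^ 2 + ((2 : ℝ) ^ nB) ^ 2) * ℓ -
        D * ((1 - κ) * δ) ^ 2)) := by
    calc _ ≤ ∑ V ∈ SA, ∑ W ∈ SB, haarState ((Qubits nA × Qubits nB) × Qubits nC)
          {ψ | τ ≤ ‖overlapMap V W (ψ : Hilb ((Qubits nA × Qubits nB) × Qubits nC))‖ ^ 2} := by
          refine (measure_mono hcover).trans ((measure_biUnion_finset_le _ _).trans ?_)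
          exact Finset.sum_le_sum fun V _ => measure_biUnion_finset_le _ _
      _ ≤ ∑ V ∈ SA, ∑ W ∈ SB, ENNReal.ofReal (Real.exp (-(D * ((1 - κ) * δ) ^ 2))) :=
          Finset.sum_le_sum fun V hV => Finset.sum_le_sum fun W hW => htail V hV W hW
      _ = ENNReal.ofReal (SA.card * (SB.card * Real.exp (-(D * ((1 - κ) * δ) ^ 2)))) := by
          rw [ENNReal.ofReal_mul (by positivity), ENNReal.ofReal_mul (by positivity)]
          simp
      _ ≤ _ := by
          refine ENNReal.ofReal_le_ofReal ?_
          calc _ ≤ Real.exp (2 * 2 ^ m * ((2 : ℝ) ^ nA) ^ 2 * ℓ) *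
                (Real.exp (2 * 2 ^ m * ((2 : ℝ) ^ nB) ^ 2 * ℓ) *
                  Real.exp (-(D * ((1 - κ) * δ) ^ 2))) := by
                gcongr
                · exact hcard nA _ hcardA
                · exact hcard nB _ hcardB
            _ = _ := by
                rw [← Real.exp_add, ← Real.exp_add]
                congr 1
                ring
  refine (ENNReal.log_le_log hprob).trans ?_
  rw [ENNReal.log_ofReal, if_neg (not_le.2 (Real.exp_pos _)), Real.log_exp, EReal.coe_le_coe_iff]
  refine hexp.trans_eq ?_
  rw [← pow_mul, mul_comm m 2]

end LOEntanglement

end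

theorem theorem2 (c : ℝ) (hc0 : 0 < c) (hc1 : c < 1) :
    ∃ K : ℝ, 0 < K ∧ ∀ (nA nB nC m : ℕ) (h δ : ℝ), 0 < h → h ≤ 1 →
      δ = h ^ 2 - (2 : ℝ)⁻¹ ^ m → 0 < δ →
      ENNReal.log
        (LOEntanglement.haarState ((LOEntanglement.Qubits nA × LOEntanglement.Qubits nB) ×
            LOEntanglement.Qubits nC)
          {ψ | (m : ℕ∞) ≤ LOEntanglement.distillableLO h (LOEntanglement.reducedAB ψ)})
      ≤ ((-c * δ ^ 2 * (2 : ℝ) ^ (nA + nB + nC) +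
          K * ((2 : ℝ) ^ (2 * m) * (((2 : ℝ) ^ nA) ^ 2 + ((2 : ℝ) ^ nB) ^ 2) * Real.log (1 / δ)) :
          ℝ) : EReal) :=
  LOEntanglement.exists_log_haarState_distillableLO_le c hc0 hc1
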